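/- Let $(\Omega,\mathcal F,\mathbb P)$ be a nonatomic probability space (every measurable set of positive probability contains a measurable subset of strictly smaller positive probability), and let $X:\Omega\to\mathbb R^N$ and $Y:\Omega\to\mathbb R^d$ be integrable random vectors with $\mathbb E(X)=0$. Let $\nu=\mathrm{Law}(X,Y)$, and let $\mu$ be the uniform probability measure on $[0,1]^d$. Let $U$ solve the correlation maximization problem with mean-independence constraint $$\max\{\mathbb E(V\cdot Y)\;:\; V \text{ a random vector on } \Omega,\ \mathrm{Law}(V)=\mu,\ \mathbb E(X\mid V)=0\},$$ and let $(\psi,\varphi,b)$ solve its dual $$\inf_{(\psi,\varphi,b)}\ \int\psi\,d\nu+\int_{[0,1]^d}\varphi\,d\mu\quad\text{subject to}\quad \psi(x,y)+\varphi(t)+b(t)\cdot x\ \ge\ t\cdot y .$$ In this dual the infimum is taken over continuous $\psi:\mathrm{spt}(\nu)\to\mathbb R$ (with $\psi\in L^1(\nu)$), $\varphi:[0,1]^d\to\mathbb R$ and $b:[0,1]^d\to\mathbb R^N$ satisfying the constraint for all $(x,y,t)\in\mathrm{spt}(\nu)\times[0,1]^d$. A solution is allowed to be merely integrable: $\psi\in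 L^1(\nu)$, $\varphi\in L^1(\mu)$ and $b\in L^1(\mu;\mathbb R^N)$ are real-valued, satisfy the constraint for $\nu$-almost every $(x,y)$ and every $t\in[0,1]^d$, and have a cost not larger than that of any continuous admissible triple. (Minimizers among continuous triples and minimizers among integrable triples are both solutions in this sense.) For $x\in\mathbb R^N$ set $\Phi_x(t)=\varphi(t)+b(t)\cdot x$ if $t\in[0,1]^d$ and $\Phi_x(t)=+\infty$ if $t\in\mathbb R^d\setminus[0,1]^d$. Let $\Phi_x^*(y)=\sup_{t}\{t\cdot y-\Phi_x(t)\}$ be its Legendre transform, $\Phi_x^{**}=(\Phi_x^*)^*$ its biconjugate, and $\mathrm{co}\,\Phi_x$ its convex envelope, $\mathrm{co}\,\Phi_x(t)=\inf\{r\in\mathbb R : (t,r)\in\mathrm{conv}(\mathrm{epi}\,\Phi_x)\}$. For $f:\mathbb R^d\to[-\infty,+\infty]$, the relation $p\in\partial f(t)$ means that $f(t)$ is finite and $f(s)\ge f(t)+p\cdot(s-t)$ for all $s\in\mathbb R^d$. Then, almost surely, $$\Phi_X(U)=\Phi_X^{**}(U)=\mathrm{co}\,\Phi_X(U),\qquad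 U\in\partial\Phi_X^*(Y),\qquad Y\in\partial\Phi_X^{**}(U),\qquad Y\in\partial(\mathrm{co}\,\Phi_X)(U).$$ -/

import Mathlib

open MeasureTheory

noncomputable section

namespace VQR

/-- Euclidean space `ℝⁿ`. -/
abbrev E (n : ℕ) : Type := EuclideanSpace ℝ (Fin n)

/-- The closed unit cube `[0,1]^d`. -/
def cube (d : ℕ) : Set (E d) := {t | ∀ i, t i ∈ Set.Icc (0 : ℝ) 1}

/-- The uniform probability measure on the unit cube. -/
def unif (d : ℕ) : Measure (E d) := volume.restrict (cube d)

/-- A measure is nonatomic if every measurable set of positive measure has a measurable subset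
of strictly smaller positive measure. -/
def Nonatomic {Ω : Type*} [MeasurableSpace Ω] (P : Measure Ω) : Prop :=
  ∀ A, MeasurableSet A → 0 < P A → ∃ B, B ⊆ A ∧ MeasurableSet B ∧ 0 < P B ∧ P B < P A

section Primal

variable {Ω : Type*} [MeasurableSpace Ω] {N d : ℕ}

/-- `V` is admissible for the correlation maximization with a mean-independence constraint:
`V` is a random vector with `Law(V) = uniform([0,1]^d)` and `𝔼(X | V) = 0`. -/
structure PrimalAdmissible (P : Measure Ω) (X : Ω → E N) (V : Ω → E d) : Prop where
  measurable : Measurable V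
  law : P.map V = unif d
  meanIndep : P[X | MeasurableSpace.comap V inferInstance] =ᵐ[P] 0

/-- `U` solves `max {𝔼(V · Y) : Law(V) = uniform([0,1]^d), 𝔼(X | V) = 0}`. -/
structure SolvesPrimal (P : Measure Ω) (X : Ω → E N) (Y : Ω → E d) (U : Ω → E d) : Prop where
  admissible : PrimalAdmissible P X U
  optimal : ∀ V : Ω → E d, PrimalAdmissible P X V →
    ∫ ω, inner ℝ (V ω) (Y ω) ∂P ≤ ∫ ω, inner ℝ (U ω) (Y ω) ∂P

end Primal

section Dual

variable {N d : ℕ}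

/-- The dual cost `𝔼(ψ(X,Y)) + 𝔼(φ(U)) = ∫ ψ dν + ∫ φ dμ`, with `μ` uniform on the cube. -/
def dualCost (ν : Measure (E N × E d)) (ψ : E N × E d → ℝ) (φ : E d → ℝ) : ℝ :=
  ∫ z, ψ z ∂ν + ∫ t, φ t ∂(unif d)

/-- Admissible triples of the dual problem: continuous potentials with the pointwise constraint
on `spt ν × [0,1]^d` (and finite cost, which is automatic when `spt ν` is compact). -/
structure ContDualAdmissible (ν : Measure (E N × E d))
    (ψ : E N × E d → ℝ) (φ : E d → ℝ) (b : E d → E N) : Prop where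
  continuousOn_psi : ContinuousOn ψ ν.support
  integrable_psi : Integrable ψ ν
  continuousOn_phi : ContinuousOn φ (cube d)
  continuousOn_b : ContinuousOn b (cube d)
  constraint : ∀ x y, (x, y) ∈ ν.support → ∀ t ∈ cube d,
    inner ℝ t y ≤ ψ (x, y) + φ t + inner ℝ (b t) x

/-- Relaxed admissible triples of the dual problem: integrable potentials, with the constraint
for `ν`-almost every `(x, y)` and every `t` in the cube. -/
structure DualAdmissible (ν : Measure (E N × E d))
    (ψ : E N × E d → ℝ) (φ : E d → ℝ) (b : E d → E N) : Prop where
  integrable_psi : Integrable ψ ν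
  integrable_phi : Integrable φ (unif d)
  integrable_b : Integrable b (unif d)
  constraint : ∀ᵐ z ∂ν, ∀ t ∈ cube d, inner ℝ t z.2 ≤ ψ z + φ t + inner ℝ (b t) z.1

/-- `(ψ, φ, b)` solves the dual problem: it is admissible in the (relaxed) integrable sense and no
continuous admissible triple has a smaller cost. Both minimizers among continuous triples and
minimizers among integrable triples are solutions in this sense. -/
structure SolvesDual (ν : Measure (E N × E d))
    (ψ : E N × E d → ℝ) (φ : E d → ℝ) (b : E d → E N) : Prop where
  admissible : DualAdmissible ν ψ φ b
  optimal : ∀ ψ' φ' b', ContDualAdmissible ν ψ' φ' b' →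
    dualCost ν ψ φ ≤ dualCost ν ψ' φ'

open Classical in
/-- `Φ_x(t) = φ(t) + b(t) · x` for `t ∈ [0,1]^d`, extended by `+∞` outside the cube. -/
def Phi (φ : E d → ℝ) (b : E d → E N) (x : E N) (t : E d) : EReal :=
  if t ∈ cube d then ((φ t + inner ℝ (b t) x : ℝ) : EReal) else ⊤

end Dual

section Convex

variable {d : ℕ}

/-- The Legendre–Fenchel transform `f^*(y) = sup_t (t · y - f(t))`. -/
def conj (f : E d → EReal) (y : E d) : EReal :=
  ⨆ t : E d, ((inner ℝ t y : ℝ) : EReal) - f t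

/-- The convex envelope (largest convex minorant) of `f`: its value at `t` is
`inf {r : (t, r) ∈ convex hull of the epigraph of f}`. -/
def convexEnvelope (f : E d → EReal) (t : E d) : EReal :=
  ⨅ r ∈ {r : ℝ | (t, r) ∈ convexHull ℝ {p : E d × ℝ | f p.1 ≤ (p.2 : EReal)}}, (r : EReal)

/-- The subdifferential of an extended-real-valued function at `t` (empty where `f t` is not
finite). -/
def subdiff (f : E d → EReal) (t : E d) : Set (E d) :=
  {y | f t ≠ ⊤ ∧ f t ≠ ⊥ ∧ ∀ s, f t + ((inner ℝ y (s - t) : ℝ) : EReal) ≤ f s}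

end Convex

end VQR

end

/-! The heart is complementary slackness: almost surely the dual constraint is an equality at `(X,
Y, U)`. Subtracting it from the constraint at a general `t` shows that `Φ_X` has an affine minorant
of slope `Y` touching it at `U`. This minorant survives biconjugation and convexification, and every
conclusion follows from it.

Slackness needs `dualCost ≤ 𝔼(U · Y)` (`SolvesPrimal.dualCost_le`). The slack is then nonnegative
with integral at most zero once `b(U) · X` is seen to contribute nothing. That product need not be
integrable, so `SolvesPrimal.ae_saturated` works on the sets where `b(U)` is bounded.

The absence of a gap is proved by discretization. Replace the cube by a finite set `s` and `V` by
labellings `τ : Ω → s`. By Lyapunov's theorem (`Splits.isCompact_convex_labelMoments`) the moments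
of labellings form a compact convex set, so Hahn–Banach separation yields multipliers
(`SolvesPrimal.exists_multipliers`). A partition of unity interpolates them into a continuous dual
triple that is nearly optimal. The separation requires that no feasible labelling much exceeds the
primal value: `exists_primalAdmissible_near` refines it to an admissible `V` on the same `Ω`,
randomizing inside each piece by a uniform variable given which `X` keeps a constant mean
(`Splits.exists_uniform`, repeated halving by Lyapunov).

Lyapunov's theorem itself is obtained by the extreme point method: a fractional partition that is
extreme under finitely many moment constraints is a genuine partition. -/

noncomputable section

namespace VQR

/-! ### Extreme points of weak-* compact sets of fractional partitions -/

section Lyapunov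

/-- Every measurable set of positive measure splits into two measurable sets of positive
measure. -/
def Splits {Ω : Type*} [MeasurableSpace Ω] (Q : Measure Ω) : Prop :=
  ∀ A, MeasurableSet A → 0 < Q A → ∃ B, B ⊆ A ∧ MeasurableSet B ∧ 0 < Q B ∧ 0 < Q (A \ B)

variable {Ω : Type*} [MeasurableSpace Ω]

lemma Nonatomic.splits {P : Measure Ω} [IsFiniteMeasure P] (hP : Nonatomic P) : Splits P := by
  intro A hA hA0
  obtain ⟨B, hBA, hB, hB0, hlt⟩ := hP A hA hA0
  refine ⟨B, hBA, hB, hB0, ?_⟩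
  rw [measure_sdiff hBA hB.nullMeasurableSet (measure_ne_top _ _)]
  exact tsub_pos_of_lt hlt

lemma Splits.of_absolutelyContinuous {P Q : Measure Ω} (hP : Splits P) (hPQ : P ≪ Q)
    (hQP : Q ≪ P) : Splits Q := by
  have key : ∀ A, 0 < Q A ↔ 0 < P A := fun A => by
    rw [pos_iff_ne_zero, pos_iff_ne_zero]
    exact not_congr ⟨fun h => hPQ h, fun h => hQP h⟩
  intro A hA hA0
  obtain ⟨B, hBA, hB, hB0, hAB⟩ := hP A hA ((key A).1 hA0)
  exact ⟨B, hBA, hB, (key _).2 hB0, (key _).2 hAB⟩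

/-- A set of positive measure splits into arbitrarily many pieces of positive measure. -/
lemma Splits.exists_labelling {Q : Measure Ω} (hQ : Splits Q) {A : Set Ω}
    (hA : MeasurableSet A) (hA0 : 0 < Q A) (n : ℕ) :
    ∃ c : Ω → ℕ, Measurable c ∧ ∀ i ≤ n, 0 < Q (A ∩ c ⁻¹' {i}) := by
  classical
  induction n with
  | zero => exact ⟨fun _ => 0, measurable_const, fun i hi => by simpa [Nat.le_zero.1 hi] using hA0⟩
  | succ n ih =>
    obtain ⟨c, hc, hpos⟩ := ih
    have hm : MeasurableSet (A ∩ c ⁻¹' {n}) := hA.inter (hc (measurableSet_singleton n))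
    obtain ⟨B, hBA, hB, hB0, hAB⟩ := hQ _ hm (hpos n le_rfl)
    refine ⟨fun ω => if ω ∈ B then n + 1 else c ω, Measurable.ite hB measurable_const hc, ?_⟩
    intro i hi
    rcases Nat.lt_or_ge i n with h | h
    · refine (hpos i h.le).trans_le (measure_mono fun ω hω => ⟨hω.1, ?_⟩)
      have hωB : ω ∉ B := fun hB' => h.ne (hω.2.symm.trans (hBA hB').2)
      simpa [hωB] using hω.2
    · rcases h.eq_or_lt with rfl | h
      · refine hAB.trans_le (measure_mono fun ω hω => ⟨hω.1.1, ?_⟩)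
        simpa [hω.2] using hω.1.2
      · obtain rfl : i = n + 1 := le_antisymm hi h
        refine hB0.trans_le (measure_mono fun ω hω => ⟨(hBA hω).1, ?_⟩)
        simp [hω]

variable (Q : Measure Ω) [IsFiniteMeasure Q] (J : Type*) [Fintype J]

/-- The constant function `1` as an element of `L²`. -/
def oneL2 : Lp ℝ 2 Q := indicatorConstLp 2 MeasurableSet.univ (measure_ne_top Q _) (1 : ℝ)

/-- Fractional partitions of `Ω`: tuples of nonnegative functions with sum `1`. -/
def fracPartitions : Set (J → Lp ℝ 2 Q) := {g | (∀ j, 0 ≤ g j) ∧ ∑ j, g j = oneL2 Q}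

/-- The Riesz map from `L²` to its dual with the weak-* topology. -/
def rieszWeak : Lp ℝ 2 Q →ₗ[ℝ] WeakDual ℝ (Lp ℝ 2 Q) where
  toFun g := StrongDual.toWeakDual (innerSL ℝ g)
  map_add' g h := by simp
  map_smul' c g := by simp

variable {Q} {J}

omit [IsFiniteMeasure Q] in
lemma rieszWeak_apply (g h : Lp ℝ 2 Q) : rieszWeak Q g h = inner ℝ g h := rfl

omit [IsFiniteMeasure Q] in
lemma rieszWeak_injective : Function.Injective (rieszWeak Q) := by
  intro g h hgh
  refine ext_inner_right ℝ fun v => ?_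
  rw [← rieszWeak_apply, hgh, rieszWeak_apply]

omit [IsFiniteMeasure Q] in
lemma rieszWeak_surjective : Function.Surjective (rieszWeak Q) := by
  intro f
  refine ⟨(InnerProductSpace.toDual ℝ _).symm (WeakDual.toStrongDual f), ?_⟩
  refine ContinuousLinearMap.ext fun h => ?_
  exact InnerProductSpace.toDual_symm_apply (𝕜 := ℝ) (E := Lp ℝ 2 Q)

omit [IsFiniteMeasure Q] in
lemma inner_nonneg_of_nonneg {g h : Lp ℝ 2 Q} (hg : 0 ≤ g) (hh : 0 ≤ h) :
    0 ≤ inner ℝ g h := by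
  rw [L2.inner_def]
  refine integral_nonneg_of_ae ?_
  filter_upwards [(Lp.coeFn_nonneg g).2 hg, (Lp.coeFn_nonneg h).2 hh] with ω h1 h2
  simp only [RCLike.inner_apply, conj_trivial]
  exact mul_nonneg h2 h1

/-- Testing against indicators suffices. This makes nonnegativity a weak-* closed condition. -/
lemma nonneg_of_forall_inner_nonneg {g : Lp ℝ 2 Q} (hg : ∀ h : Lp ℝ 2 Q, 0 ≤ h → 0 ≤ inner ℝ g h) :
    0 ≤ g := by
  rw [← Lp.coeFn_nonneg]
  refine ae_nonneg_of_forall_setIntegral_nonneg ((Lp.memLp g).integrable (by norm_num))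
    fun s hs _ => ?_
  rw [← L2.inner_indicatorConstLp_one (𝕜 := ℝ) hs (measure_ne_top Q s), real_inner_comm]
  refine hg _ ?_
  rw [← Lp.coeFn_nonneg]
  filter_upwards [indicatorConstLp_coeFn (p := 2) (hs := hs) (hμs := measure_ne_top Q s)
    (c := (1 : ℝ))] with ω hω
  rw [hω]
  exact Set.indicator_nonneg (fun _ _ => zero_le_one) _

variable (Q J) in
/-- Fractional partitions are compact for the weak-* topology. -/
lemma isCompact_image_fracPartitions :
    IsCompact ((fun g (j : J) => rieszWeak Q (g j)) '' fracPartitions Q J) := by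
  have hball : IsCompact (Set.univ.pi fun _ : J =>
      (WeakDual.toStrongDual ⁻¹' Metric.closedBall (0 : StrongDual ℝ (Lp ℝ 2 Q)) ‖oneL2 Q‖)) :=
    isCompact_univ_pi fun _ => WeakDual.isCompact_closedBall (𝕜 := ℝ) _ _
  have hev : ∀ (j : J) (h : Lp ℝ 2 Q),
      Continuous fun f : J → WeakDual ℝ (Lp ℝ 2 Q) => f j h := fun j h =>
    (WeakDual.eval_continuous h).comp (continuous_apply j)
  refine hball.of_isClosed_subset (?_ : IsClosed _) ?_
  -- Surjectivity of the Riesz map turns the image into an intersection of weak-* closed half-spaces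
  -- and hyperplanes.
  · have : (fun g (j : J) => rieszWeak Q (g j)) '' fracPartitions Q J =
        (⋂ j : J, ⋂ h : Lp ℝ 2 Q, ⋂ _ : 0 ≤ h, {f | 0 ≤ f j h}) ∩
        ⋂ h : Lp ℝ 2 Q, {f | ∑ j, f j h = inner ℝ (oneL2 Q) h} := by
      ext f
      simp only [Set.mem_image, Set.mem_inter_iff, Set.mem_iInter, Set.mem_ofPred_eq]
      constructor
      · rintro ⟨g, ⟨hg0, hg1⟩, rfl⟩
        refine ⟨fun j h hh => inner_nonneg_of_nonneg (hg0 j) hh, fun h => ?_⟩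
        rw [← hg1, sum_inner]
        rfl
      · rintro ⟨h0, h1⟩
        choose g hg using fun j => rieszWeak_surjective (f j)
        refine ⟨g, ⟨fun j => nonneg_of_forall_inner_nonneg fun h hh => ?_, ?_⟩, funext hg⟩
        · have := h0 j h hh
          rwa [← hg j] at this
        · refine ext_inner_right ℝ fun v => ?_
          rw [sum_inner, ← h1 v]
          exact Finset.sum_congr rfl fun j _ => by rw [← hg j]; rfl
    rw [this]
    refine IsClosed.inter ?_ ?_
    · exact isClosed_iInter fun j => isClosed_iInter fun h => isClosed_iInter fun _ =>
        isClosed_le continuous_const (hev j h)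
    · exact isClosed_iInter fun h => isClosed_eq
        (continuous_finsetSum _ fun j _ => hev j h) continuous_const
  · rintro _ ⟨g, ⟨hg0, hg1⟩, rfl⟩ j -
    rw [Set.mem_preimage, mem_closedBall_zero_iff]
    refine ContinuousLinearMap.opNorm_le_bound _ (norm_nonneg _) fun h => ?_
    change ‖inner ℝ (g j) h‖ ≤ _
    have hle : g j ≤ oneL2 Q := by
      rw [← hg1]
      exact Finset.single_le_sum (fun i _ => hg0 i) (Finset.mem_univ j)
    have : ‖g j‖ ≤ ‖oneL2 Q‖ := norm_le_norm_of_abs_le_abs (by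
      rwa [abs_of_nonneg (hg0 j), abs_of_nonneg ((hg0 j).trans hle)])
    exact (norm_inner_le_norm _ _).trans (mul_le_mul_of_nonneg_right this (norm_nonneg _))

lemma convex_fracPartitions : Convex ℝ (fracPartitions Q J) := by
  rintro g ⟨hg0, hg1⟩ h ⟨hh0, hh1⟩ a b ha hb hab
  refine ⟨fun j => nonneg_of_forall_inner_nonneg fun v hv => ?_, ?_⟩
  · simp only [Pi.add_apply, Pi.smul_apply, inner_add_left, real_inner_smul_left]
    exact add_nonneg (mul_nonneg ha (inner_nonneg_of_nonneg (hg0 j) hv))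
      (mul_nonneg hb (inner_nonneg_of_nonneg (hh0 j) hv))
  simp only [Pi.add_apply, Pi.smul_apply, Finset.sum_add_distrib, ← Finset.smul_sum, hg1, hh1]
  rw [← add_smul, hab, one_smul]

/-- A set of positive measure carries small nonzero functions orthogonal to finitely many given
ones. -/
lemma Splits.exists_orthogonal (hQ : Splits Q) {A : Set Ω} (hA : MeasurableSet A) (hA0 : 0 < Q A)
    {κ : Type*} [Fintype κ] (G : κ → Lp ℝ 2 Q) {ε : ℝ} (hε : 0 < ε) :
    ∃ u : Lp ℝ 2 Q, u ≠ 0 ∧ (∀ k, inner ℝ u (G k) = 0) ∧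
      ∀ᵐ ω ∂Q, |u ω| ≤ A.indicator (fun _ => ε) ω := by
  classical
  set n := Fintype.card κ
  obtain ⟨c, hc, hpos⟩ := hQ.exists_labelling hA hA0 n
  let S : Fin (n + 1) → Set Ω := fun l => A ∩ c ⁻¹' {(l : ℕ)}
  have hS : ∀ l, MeasurableSet (S l) := fun l => hA.inter (hc (measurableSet_singleton _))
  let e : Fin (n + 1) → Lp ℝ 2 Q := fun l =>
    indicatorConstLp 2 (hS l) (measure_ne_top Q _) (1 : ℝ)
  -- One more coefficient than orthogonality conditions, hence a nontrivial kernel.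
  let Λ : (Fin (n + 1) → ℝ) →ₗ[ℝ] (κ → ℝ) :=
    { toFun := fun a k => inner ℝ (∑ l, a l • e l) (G k)
      map_add' := fun a a' => by
        ext k; simp [add_smul, Finset.sum_add_distrib, inner_add_left]
      map_smul' := fun r a => by
        ext k; simp [mul_smul, ← Finset.smul_sum, real_inner_smul_left] }
  have hker : LinearMap.ker Λ ≠ ⊥ := Λ.ker_ne_bot_of_finrank_lt (by simp [n])
  obtain ⟨a, haker, ha0⟩ := (Submodule.ne_bot_iff _).1 hker
  obtain ⟨l₀, hl₀⟩ : ∃ l, a l ≠ 0 := Function.ne_iff.1 ha0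
  set M := ∑ l, |a l|
  have hM : 0 < M := (abs_pos.2 hl₀).trans_le
    (Finset.single_le_sum (f := fun l => |a l|) (fun _ _ => abs_nonneg _) (Finset.mem_univ l₀))
  have hval : ∀ᵐ ω ∂Q, (∑ l, a l • e l : Lp ℝ 2 Q) ω =
      ∑ l, a l * (S l).indicator (fun _ => (1 : ℝ)) ω := by
    have h1 : ∀ᵐ ω ∂Q, ∀ l, (a l • e l : Lp ℝ 2 Q) ω =
        a l * (S l).indicator (fun _ => (1 : ℝ)) ω := by
      refine ae_all_iff.2 fun l => ?_
      filter_upwards [Lp.coeFn_smul (a l) (e l), indicatorConstLp_coeFn (p := 2) (hs := hS l)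
        (hμs := measure_ne_top Q _) (c := (1 : ℝ))] with ω h1 h2
      rw [h1, Pi.smul_apply, smul_eq_mul, h2]
    filter_upwards [Lp.coeFn_fun_finsetSum Finset.univ fun l => a l • e l, h1] with ω h2 h3
    rw [h2]
    exact Finset.sum_congr rfl fun l _ => h3 l
  have hk : ∀ k, inner ℝ (∑ l, a l • e l) (G k) = 0 := fun k => congrFun haker k
  refine ⟨(ε / M) • ∑ l, a l • e l, ?_, fun k => ?_, ?_⟩
  -- The pieces are disjoint, so the combination equals `a l₀ ≠ 0` on `S l₀`, a set of positive
  -- measure.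
  · refine smul_ne_zero (div_pos hε hM).ne' fun h0 => ?_
    have hz : ∀ᵐ ω ∂Q, ω ∉ S l₀ := by
      filter_upwards [hval, (Lp.coeFn_zero ℝ 2 Q : _ =ᵐ[Q] _)] with ω h1 h2 hω
      rw [h0, h2, Finset.sum_eq_single l₀] at h1
      · simp only [Pi.zero_apply, Set.indicator_of_mem hω, mul_one] at h1
        exact hl₀ h1.symm
      · intro l _ hl
        rw [Set.indicator_of_notMem, mul_zero]
        exact fun h => hl (Fin.ext (h.2.symm.trans hω.2))
      · simp
    have := measure_eq_zero_iff_ae_notMem.2 hz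
    exact (hpos l₀ (Nat.lt_succ_iff.1 l₀.2)).ne' this
  · rw [real_inner_smul_left, hk, mul_zero]
  · filter_upwards [hval, Lp.coeFn_smul (ε / M) (∑ l, a l • e l : Lp ℝ 2 Q)] with ω h1 h2
    rw [h2, Pi.smul_apply, h1, smul_eq_mul]
    by_cases hω : ω ∈ A
    · rw [Set.indicator_of_mem hω, abs_mul, abs_of_pos (div_pos hε hM), div_mul_eq_mul_div,
        div_le_iff₀ hM]
      refine mul_le_mul_of_nonneg_left ?_ hε.le
      refine (Finset.abs_sum_le_sum_abs _ _).trans (Finset.sum_le_sum fun l _ => ?_)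
      rw [abs_mul]
      refine mul_le_of_le_one_right (abs_nonneg _) ?_
      by_cases h : ω ∈ S l <;> simp [h]
    · rw [Finset.sum_eq_zero fun l _ => ?_]
      · simp [hω]
      · rw [Set.indicator_of_notMem (fun h => hω h.1), mul_zero]

/-- Moments of fractional partitions are moments of fractional partitions with disjoint
supports. -/
lemma Splits.exists_disjoint_fracPartition (hQ : Splits Q) {κ : Type*} [Fintype κ]
    (G : κ → J → Lp ℝ 2 Q) {g₀ : J → Lp ℝ 2 Q} (hg₀ : g₀ ∈ fracPartitions Q J) :
    ∃ g ∈ fracPartitions Q J, (∀ k, ∑ j, inner ℝ (g j) (G k j) = ∑ j, inner ℝ (g₀ j) (G k j)) ∧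
      ∀ i j, i ≠ j → ∀ᵐ ω ∂Q, g i ω * g j ω = 0 := by
  classical
  let R : (J → Lp ℝ 2 Q) → (J → WeakDual ℝ (Lp ℝ 2 Q)) := fun g j => rieszWeak Q (g j)
  let T : Set (J → Lp ℝ 2 Q) :=
    {g ∈ fracPartitions Q J | ∀ k, ∑ j, inner ℝ (g j) (G k j) = ∑ j, inner ℝ (g₀ j) (G k j)}
  have hRinj : Function.Injective R := fun g h hgh =>
    funext fun j => rieszWeak_injective (congrFun hgh j)
  have hcomp : IsCompact (R '' T) := by
    have : R '' T = R '' fracPartitions Q J ∩ ⋂ k,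
        {f | ∑ j, f j (G k j) = ∑ j, inner ℝ (g₀ j) (G k j)} := by
      ext f
      simp only [Set.mem_image, Set.mem_inter_iff, Set.mem_iInter, Set.mem_ofPred_eq]
      constructor
      · rintro ⟨g, hg, rfl⟩
        exact ⟨⟨g, hg.1, rfl⟩, hg.2⟩
      · rintro ⟨⟨g, hg, rfl⟩, h⟩
        exact ⟨g, ⟨hg, h⟩, rfl⟩
    rw [this]
    refine (isCompact_image_fracPartitions Q J).inter_right (isClosed_iInter fun k => ?_)
    exact isClosed_eq (continuous_finsetSum _ fun j _ =>
      (WeakDual.eval_continuous (G k j)).comp (continuous_apply j)) continuous_const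
  have : LocallyConvexSpace ℝ (WeakDual ℝ (Lp ℝ 2 Q)) :=
    WeakBilin.locallyConvexSpace (B := topDualPairing ℝ (Lp ℝ 2 Q))
  -- An extreme point among the fractional partitions with the given moments has disjoint supports;
  -- otherwise mass could be shifted both ways between two overlapping components.
  obtain ⟨_, hf⟩ := hcomp.extremePoints_nonempty ⟨R g₀, g₀, ⟨hg₀, fun _ => rfl⟩, rfl⟩
  obtain ⟨⟨g, hgT, rfl⟩, hext⟩ := mem_extremePoints_iff_left.1 hf
  refine ⟨g, hgT.1, hgT.2, fun i j hij => ?_⟩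
  by_contra hne
  have hmeas : ∀ j, Measurable (g j) := fun j => (Lp.stronglyMeasurable (g j)).measurable
  have hpos : ∀ᵐ ω ∂Q, ∀ j, 0 ≤ g j ω := ae_all_iff.2 fun j => (Lp.coeFn_nonneg _).2 (hgT.1.1 j)
  let A : ℕ → Set Ω := fun n => {ω | 1 / ((n : ℝ) + 1) ≤ g i ω} ∩ {ω | 1 / ((n : ℝ) + 1) ≤ g j ω}
  have hA : ∀ n, MeasurableSet (A n) := fun n =>
    (measurableSet_le measurable_const (hmeas i)).inter
      (measurableSet_le measurable_const (hmeas j))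
  obtain ⟨n, hn⟩ : ∃ n, 0 < Q (A n) := by
    refine exists_measure_pos_of_not_measure_iUnion_null fun h0 => hne ?_
    filter_upwards [measure_eq_zero_iff_ae_notMem.1 h0, hpos] with ω h1 h2
    by_contra h3
    have h4 : 0 < g i ω ∧ 0 < g j ω :=
      ⟨(h2 i).lt_of_ne fun h => h3 (by rw [← h, zero_mul]),
        (h2 j).lt_of_ne fun h => h3 (by rw [← h, mul_zero])⟩
    obtain ⟨n, hn⟩ := exists_nat_one_div_lt (lt_min h4.1 h4.2)
    exact h1 (Set.mem_iUnion.2 ⟨n, (hn.trans_le (min_le_left _ _)).le,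
      (hn.trans_le (min_le_right _ _)).le⟩)
  -- Moving `u` from component `j` to component `i` changes the `k`-th moment by the inner product
  -- with `G k i - G k j`.
  obtain ⟨u, hu0, huG, hub⟩ := hQ.exists_orthogonal (hA n) hn (fun k => G k i - G k j)
    (Nat.one_div_pos_of_nat (α := ℝ) (n := n))
  have hub' : ∀ᵐ ω ∂Q, |u ω| ≤ g i ω ∧ |u ω| ≤ g j ω := by
    filter_upwards [hub, hpos] with ω h1 h2
    by_cases hω : ω ∈ A n
    · rw [Set.indicator_of_mem hω] at h1
      exact ⟨h1.trans hω.1, h1.trans hω.2⟩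
    · rw [Set.indicator_of_notMem hω] at h1
      exact ⟨h1.trans (h2 i), h1.trans (h2 j)⟩
  let D : Lp ℝ 2 Q → J → Lp ℝ 2 Q := fun v => Pi.single i v - Pi.single j v
  have hsumD : ∀ v, ∑ l, D v l = 0 := fun v => by
    simp [D, Finset.sum_sub_distrib]
  have hmem : ∀ v : Lp ℝ 2 Q, (∀ k, inner ℝ v (G k i - G k j) = 0) →
      (∀ᵐ ω ∂Q, -v ω ≤ g i ω ∧ v ω ≤ g j ω) → g + D v ∈ T := by
    intro v hvG hvb
    refine ⟨⟨fun l => ?_, ?_⟩, fun k => ?_⟩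
    · rw [← Lp.coeFn_nonneg]
      have hl : (g + D v) l = if l = i then g i + v else if l = j then g j - v else g l := by
        rcases eq_or_ne l i with rfl | hli
        · simp [D, hij]
        · rcases eq_or_ne l j with rfl | hlj
          · simp [D, hli, sub_eq_add_neg]
          · simp [D, hli, hlj]
      rw [hl]
      split_ifs with h1 h2
      · filter_upwards [hvb, Lp.coeFn_add (g i) v] with ω h3 h4
        rw [h4, Pi.add_apply, Pi.zero_apply]; linarith [h3.1]
      · filter_upwards [hvb, Lp.coeFn_sub (g j) v] with ω h3 h4
        rw [h4, Pi.sub_apply, Pi.zero_apply]; linarith [h3.2]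
      · exact (Lp.coeFn_nonneg _).2 (hgT.1.1 l)
    · simp only [Pi.add_apply, Finset.sum_add_distrib, hsumD, add_zero, hgT.1.2]
    · rw [← hgT.2 k]
      simp only [Pi.add_apply, inner_add_left, Finset.sum_add_distrib]
      rw [add_eq_left]
      have : ∀ l, inner ℝ (D v l) (G k l) =
          (if l = i then inner ℝ v (G k l) else 0) - (if l = j then inner ℝ v (G k l) else 0) := by
        intro l
        simp only [D, Pi.sub_apply, inner_sub_left, Pi.single_apply]
        congr 1 <;> split_ifs <;> simp
      simp only [this, Finset.sum_sub_distrib, Finset.sum_ite_eq', Finset.mem_univ, if_true]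
      rw [← inner_sub_right, hvG k]
  have h1 : g + D u ∈ T := hmem u huG (by
    filter_upwards [hub'] with ω h
    exact ⟨(neg_le_abs _).trans h.1, (le_abs_self _).trans h.2⟩)
  have h2 : g + D (-u) ∈ T := hmem (-u) (fun k => by rw [inner_neg_left, huG, neg_zero]) (by
    filter_upwards [hub', Lp.coeFn_neg u] with ω h h'
    rw [h', Pi.neg_apply, neg_neg]
    exact ⟨(le_abs_self _).trans h.1, (neg_le_abs _).trans h.2⟩)
  have hDneg : D (-u) = -D u := by simp [D, Pi.single_neg, sub_eq_add_neg, add_comm]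
  have hRadd : ∀ g h, R (g + h) = R g + R h := fun g h => funext fun j => map_add _ _ _
  have hRneg : ∀ g, R (-g) = -R g := fun g => funext fun j => map_neg _ _
  -- `g` is the midpoint of `g + D u` and `g - D u`, so extremality forces `u = 0`.
  have h3 := hext _ ⟨_, h1, rfl⟩ _ ⟨_, h2, rfl⟩ ⟨1 / 2, 1 / 2, by norm_num, by norm_num,
    by norm_num, by rw [hDneg, hRadd, hRadd, hRneg]; module⟩
  have h4 := congrFun (hRinj h3) i
  simp [D, hij] at h4
  exact hu0 h4

end Lyapunov

/-! ### Lyapunov's convexity theorem for labellings -/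

section LyapunovPartitions

variable {Ω : Type*} [MeasurableSpace Ω] {Q : Measure Ω} [IsFiniteMeasure Q] {J : Type*} [Fintype J]

lemma oneL2_ae : ∀ᵐ ω ∂Q, oneL2 Q ω = 1 := by
  filter_upwards [indicatorConstLp_coeFn (p := 2) (hs := MeasurableSet.univ)
    (hμs := measure_ne_top Q _) (c := (1 : ℝ))] with ω hω
  rw [oneL2, hω]
  simp

lemma sum_fracPartition_ae {g : J → Lp ℝ 2 Q} (hg : g ∈ fracPartitions Q J) :
    ∀ᵐ ω ∂Q, ∑ j, g j ω = 1 := by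
  filter_upwards [Lp.coeFn_fun_finsetSum Finset.univ g, oneL2_ae (Q := Q)] with ω h1 h2
  rw [← h1, hg.2, h2]

variable [MeasurableSpace J] [MeasurableSingletonClass J]

omit [MeasurableSingletonClass J] in
/-- Measurable selection from a finite set. -/
lemma exists_measurable_selection [Nonempty J] {p : Ω → J → Prop}
    (hp : ∀ j, MeasurableSet {ω | p ω j}) :
    ∃ τ : Ω → J, Measurable τ ∧ ∀ ω, (∃ j, p ω j) → p ω (τ ω) := by
  classical
  -- The choice sees `ω` only through the pattern of valid labels, a point of a countable space, so
  -- it is automatically measurable.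
  let c : (J → Prop) → J := fun v => if h : ∃ j, v j then h.choose else Classical.arbitrary J
  refine ⟨fun ω => c (p ω), (measurable_of_countable c).comp
    (measurable_pi_lambda _ fun j => measurableSet_setOfPred.1 (hp j)), fun ω h => ?_⟩
  have hc : c (p ω) = h.choose := dif_pos h
  simp only [hc]
  exact h.choose_spec

-- Almost everywhere exactly one component is nonzero, and since the sum is one it equals one there;
-- the label is its index.
omit [MeasurableSingletonClass J] in
lemma exists_label_of_disjoint [Nonempty J] {g : J → Lp ℝ 2 Q} (hg : g ∈ fracPartitions Q J)
    (hdisj : ∀ i j, i ≠ j → ∀ᵐ ω ∂Q, g i ω * g j ω = 0) :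
    ∃ τ : Ω → J, Measurable τ ∧
      ∀ j, ∀ᵐ ω ∂Q, g j ω = (τ ⁻¹' {j}).indicator (fun _ => (1 : ℝ)) ω := by
  obtain ⟨τ, hτ, hsel⟩ := exists_measurable_selection (p := fun ω j => g j ω ≠ 0) fun j =>
    (Lp.stronglyMeasurable (g j)).measurable (measurableSet_singleton 0).compl
  refine ⟨τ, hτ, fun j => ?_⟩
  have hd : ∀ᵐ ω ∂Q, ∀ i j, i ≠ j → g i ω * g j ω = 0 :=
    ae_all_iff.2 fun i => ae_all_iff.2 fun j => Filter.eventually_imp_distrib_left.2 (hdisj i j)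
  filter_upwards [hd, sum_fracPartition_ae hg] with ω h1 h2
  have hτ0 : g (τ ω) ω ≠ 0 := hsel ω (by
    by_contra! hcon
    rw [Finset.sum_eq_zero fun j _ => hcon j] at h2
    exact zero_ne_one h2)
  have h0 : ∀ i, i ≠ τ ω → g i ω = 0 := fun i hi =>
    (mul_eq_zero.1 (h1 i _ hi)).resolve_right hτ0
  rcases eq_or_ne (τ ω) j with hj | hj
  · rw [Set.indicator_of_mem (by exact hj), ← hj, ← h2]
    exact (Finset.sum_eq_single _ (fun i _ hi => h0 i hi) (by simp)).symm
  · rw [Set.indicator_of_notMem (by exact hj), h0 j hj.symm]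

omit [IsFiniteMeasure Q] [MeasurableSpace J] [MeasurableSingletonClass J] in
lemma sum_inner_eq_integral_label {τ : Ω → J} {g : J → Lp ℝ 2 Q}
    (hg : ∀ j, ∀ᵐ ω ∂Q, g j ω = (τ ⁻¹' {j}).indicator (fun _ => (1 : ℝ)) ω)
    {F : J → Ω → ℝ} (hF : ∀ j, MemLp (F j) 2 Q) :
    ∑ j, inner ℝ (g j) ((hF j).toLp (F j)) = ∫ ω, F (τ ω) ω ∂Q := by
  simp only [L2.inner_def]
  rw [← integral_finsetSum _ fun j _ => L2.integrable_inner _ _]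
  refine integral_congr_ae ?_
  filter_upwards [ae_all_iff.2 hg, ae_all_iff.2 fun j => (hF j).coeFn_toLp] with ω h1 h2
  rw [Finset.sum_eq_single (τ ω)]
  · rw [h1, h2, Set.indicator_of_mem (by simp)]
    simp
  · intro j _ hj
    rw [h1, Set.indicator_of_notMem (s := τ ⁻¹' {j}) (fun h : τ ω = j => hj h.symm)]
    simp
  · simp

lemma exists_fracPartition_of_label {τ : Ω → J} (hτ : Measurable τ) :
    ∃ g ∈ fracPartitions Q J,
      ∀ j, ∀ᵐ ω ∂Q, g j ω = (τ ⁻¹' {j}).indicator (fun _ => (1 : ℝ)) ω := by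
  let g : J → Lp ℝ 2 Q := fun j => indicatorConstLp 2 (hτ (measurableSet_singleton j))
    (measure_ne_top Q _) (1 : ℝ)
  have hg : ∀ j, ∀ᵐ ω ∂Q, g j ω = (τ ⁻¹' {j}).indicator (fun _ => (1 : ℝ)) ω := fun j =>
    indicatorConstLp_coeFn
  refine ⟨g, ⟨fun j => ?_, ?_⟩, hg⟩
  · rw [← Lp.coeFn_nonneg]
    filter_upwards [hg j] with ω h
    rw [h]
    exact Set.indicator_nonneg (fun _ _ => zero_le_one) _
  · refine Lp.ext ?_
    filter_upwards [Lp.coeFn_fun_finsetSum Finset.univ g, oneL2_ae (Q := Q),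
      ae_all_iff.2 hg] with ω h1 h2 h3
    rw [h1, h2, Finset.sum_eq_single (τ ω)]
    · rw [h3, Set.indicator_of_mem (by simp)]
    · intro j _ hj
      rw [h3, Set.indicator_of_notMem (s := τ ⁻¹' {j}) (fun h : τ ω = j => hj h.symm)]
    · simp

/-- The set of moments of measurable labellings. -/
def labelMoments {κ : Type*} (Q : Measure Ω) (F : κ → J → Ω → ℝ) : Set (κ → ℝ) :=
  {x | ∃ τ : Ω → J, Measurable τ ∧ ∀ k, x k = ∫ ω, F k (τ ω) ω ∂Q}

/-- Relaxing labellings to fractional partitions creates no new moments, and the relaxed set is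
convex and weak-* compact. -/
lemma Splits.isCompact_convex_labelMoments_of_memLp [Nonempty J] (hQ : Splits Q) {κ : Type*} [Fintype κ]
    {F : κ → J → Ω → ℝ} (hF : ∀ k j, MemLp (F k j) 2 Q) :
    IsCompact (labelMoments Q F) ∧ Convex ℝ (labelMoments Q F) := by
  let G : κ → J → Lp ℝ 2 Q := fun k j => (hF k j).toLp (F k j)
  let M : (J → WeakDual ℝ (Lp ℝ 2 Q)) → κ → ℝ := fun f k => ∑ j, f j (G k j)
  have hM : Continuous M := continuous_pi fun k => continuous_finsetSum _ fun j _ =>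
    (WeakDual.eval_continuous (G k j)).comp (continuous_apply j)
  let I : (J → Lp ℝ 2 Q) →ₗ[ℝ] κ → ℝ :=
    { toFun := fun g k => ∑ j, inner ℝ (g j) (G k j)
      map_add' := fun g h => by
        ext k; simp [inner_add_left, Finset.sum_add_distrib]
      map_smul' := fun c g => by
        ext k; simp [real_inner_smul_left, Finset.mul_sum] }
  have hK : labelMoments Q F = I '' fracPartitions Q J := by
    ext x
    constructor
    · rintro ⟨τ, hτ, hx⟩
      obtain ⟨g, hg, hgτ⟩ := exists_fracPartition_of_label (Q := Q) hτ
      exact ⟨g, hg, funext fun k => (sum_inner_eq_integral_label hgτ (hF k)).trans (hx k).symm⟩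
    · rintro ⟨g₀, hg₀, rfl⟩
      obtain ⟨g, hg, hgG, hgd⟩ := hQ.exists_disjoint_fracPartition G hg₀
      obtain ⟨τ, hτ, hgτ⟩ := exists_label_of_disjoint hg hgd
      exact ⟨τ, hτ, fun k => (hgG k).symm.trans (sum_inner_eq_integral_label hgτ (hF k))⟩
  rw [hK]
  refine ⟨?_, convex_fracPartitions.linear_image I⟩
  have := (isCompact_image_fracPartitions Q J).image hM
  rwa [Set.image_image] at this

/-- **Lyapunov's theorem** for partitions: on a nonatomic space, the moments of measurable
labellings form a compact convex set. -/
theorem Splits.isCompact_convex_labelMoments [Nonempty J] {P : Measure Ω} [IsFiniteMeasure P] (hP : Splits P)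
    {κ : Type*} [Fintype κ]
    {F : κ → J → Ω → ℝ} (hF : ∀ k j, Integrable (F k j) P) :
    IsCompact (labelMoments P F) ∧ Convex ℝ (labelMoments P F) := by
  let F' : κ → J → Ω → ℝ := fun k j => (hF k j).1.mk (F k j)
  have hF'm : ∀ k j, Measurable (F' k j) := fun k j =>
    (hF k j).1.stronglyMeasurable_mk.measurable
  have hFF' : ∀ᵐ ω ∂P, ∀ k j, F k j ω = F' k j ω :=
    ae_all_iff.2 fun k => ae_all_iff.2 fun j => (hF k j).1.ae_eq_mk
  have hF' : ∀ k j, Integrable (F' k j) P := fun k j => (hF k j).congr (hF k j).1.ae_eq_mk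
  -- Reweighting by `ρ` reduces `L¹` to `L²`: the functions `F' / ρ` are bounded, their integrals
  -- against `ρ P` are the original ones, and the two measures are equivalent.
  let ρ : Ω → ℝ := fun ω => 1 + ∑ k, ∑ j, |F' k j ω|
  have hρ1 : ∀ ω, 1 ≤ ρ ω := fun ω => le_add_of_nonneg_right
    (Finset.sum_nonneg fun k _ => Finset.sum_nonneg fun j _ => abs_nonneg _)
  have hρ0 : ∀ ω, 0 < ρ ω := fun ω => zero_lt_one.trans_le (hρ1 ω)
  have hρm : Measurable ρ := by
    refine measurable_const.add (Finset.measurable_sum _ fun k _ =>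
      Finset.measurable_sum _ fun j _ => ?_)
    exact (hF'm k j).abs
  have hρi : Integrable ρ P := (integrable_const 1).add
    (integrable_finsetSum _ fun k _ => integrable_finsetSum _ fun j _ => (hF' k j).abs)
  let Q : Measure Ω := P.withDensity fun ω => ENNReal.ofReal (ρ ω)
  have hQfin : IsFiniteMeasure Q := isFiniteMeasure_withDensity_ofReal hρi.2
  have hQP : Q ≪ P := withDensity_absolutelyContinuous _ _
  have hPQ : P ≪ Q := withDensity_absolutelyContinuous' hρm.ennreal_ofReal.aemeasurable
    (Filter.Eventually.of_forall fun ω => by simpa using hρ0 ω)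
  have hQ : Splits Q := hP.of_absolutelyContinuous hPQ hQP
  have hL2 : ∀ k j, MemLp (fun ω => F' k j ω / ρ ω) 2 Q := fun k j => by
    refine MemLp.of_bound ((hF'm k j).div hρm).aestronglyMeasurable 1
      (Filter.Eventually.of_forall fun ω => ?_)
    rw [Real.norm_eq_abs, abs_div, abs_of_pos (hρ0 ω), div_le_one (hρ0 ω)]
    have h1 : |F' k j ω| ≤ ∑ j, |F' k j ω| :=
      Finset.single_le_sum (f := fun j => |F' k j ω|) (fun _ _ => abs_nonneg _) (Finset.mem_univ j)
    have h2 : ∑ j, |F' k j ω| ≤ ∑ k, ∑ j, |F' k j ω| :=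
      Finset.single_le_sum (f := fun k => ∑ j, |F' k j ω|)
        (fun _ _ => Finset.sum_nonneg fun _ _ => abs_nonneg _) (Finset.mem_univ k)
    simp only [ρ]
    linarith
  have hK : labelMoments P F = labelMoments Q fun k j ω => F' k j ω / ρ ω := by
    have key : ∀ (τ : Ω → J) k, ∫ ω, F' k (τ ω) ω / ρ ω ∂Q = ∫ ω, F k (τ ω) ω ∂P := by
      intro τ k
      rw [integral_withDensity_eq_integral_toReal_smul hρm.ennreal_ofReal
        (Filter.Eventually.of_forall fun _ => ENNReal.ofReal_lt_top)]
      refine integral_congr_ae ?_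
      filter_upwards [hFF'] with ω hω
      rw [ENNReal.toReal_ofReal (hρ0 ω).le, smul_eq_mul, mul_div_cancel₀ _ (hρ0 ω).ne', hω]
    ext x
    simp only [labelMoments, key]
  rw [hK]
  exact hQ.isCompact_convex_labelMoments_of_memLp hL2

end LyapunovPartitions

/-! ### A uniform variable preserving finitely many conditional means -/

section Randomization

open Filter Topology

variable {Ω : Type*} [MeasurableSpace Ω]

/-- `f` takes values in `{0, …, 2 ^ n - 1}` and divides the integral of `F` into equal parts. -/
structure DyadicSplit (P : Measure Ω) (F : Ω → ℝ) (n : ℕ) (f : Ω → ℕ) : Prop where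
  measurable : Measurable f
  ae_lt : ∀ᵐ ω ∂P, f ω < 2 ^ n
  setIntegral : ∀ l < 2 ^ n, ∫ ω in f ⁻¹' {l}, F ω ∂P = (∫ ω, F ω ∂P) / 2 ^ n

/-- The factor `h (f / 2 ^ n)` is constant on level sets of `f`, which carry equal shares of `F`;
the result is a Riemann sum of `h` times the total integral. -/
lemma DyadicSplit.integral_mul {P : Measure Ω} {F : Ω → ℝ} {n : ℕ} {f : Ω → ℕ}
    (hf : DyadicSplit P F n f) (hF : Integrable F P) (h : ℝ → ℝ) :
    ∫ ω, h (f ω / 2 ^ n) * F ω ∂P =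
      (∑ l ∈ Finset.range (2 ^ n), h (l / 2 ^ n) / 2 ^ n) * ∫ ω, F ω ∂P := by
  have hm : ∀ l, MeasurableSet (f ⁻¹' {l}) := fun l => hf.measurable (measurableSet_singleton l)
  have h1 : ∫ ω, h (f ω / 2 ^ n) * F ω ∂P =
      ∫ ω, ∑ l ∈ Finset.range (2 ^ n), h (l / 2 ^ n) * (f ⁻¹' {l}).indicator F ω ∂P := by
    refine integral_congr_ae ?_
    filter_upwards [hf.ae_lt] with ω hω
    rw [Finset.sum_eq_single (f ω)]
    · rw [Set.indicator_of_mem (by simp)]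
    · intro l _ hl
      rw [Set.indicator_of_notMem (s := f ⁻¹' {l}) (fun h : f ω = l => hl h.symm), mul_zero]
    · simp [hω]
  rw [h1, integral_finsetSum _ fun l _ => (hF.indicator (hm l)).const_mul _, Finset.sum_mul]
  refine Finset.sum_congr rfl fun l hl => ?_
  rw [integral_const_mul, integral_indicator (hm l), hf.setIntegral l (Finset.mem_range.1 hl)]
  ring

lemma DyadicSplit.tendsto {P : Measure Ω} {F : Ω → ℝ} {f : ℕ → Ω → ℕ}
    (hf : ∀ n, DyadicSplit P F n (f n)) (hF : Integrable F P) {W : Ω → ℝ}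
    (hW : ∀ᵐ ω ∂P, Tendsto (fun n => (f n ω : ℝ) / 2 ^ n) atTop (𝓝 (W ω)))
    (h : BoundedContinuousFunction ℝ ℝ) :
    Tendsto (fun n => (∑ l ∈ Finset.range (2 ^ n), h (l / 2 ^ n) / 2 ^ n) * ∫ ω, F ω ∂P) atTop
      (𝓝 (∫ ω, h (W ω) * F ω ∂P)) := by
  simp_rw [← fun n => (hf n).integral_mul hF h]
  refine tendsto_integral_of_dominated_convergence (fun ω => ‖h‖ * ‖F ω‖) (fun n => ?_)
    (hF.norm.const_mul _) (fun n => ?_) ?_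
  · have : Measurable fun ω => h ((f n ω : ℝ) / 2 ^ n) := h.continuous.measurable.comp
      ((measurable_from_nat (f := fun l : ℕ => (l : ℝ) / 2 ^ n)).comp (hf n).measurable)
    exact this.aestronglyMeasurable.mul hF.1
  · refine Eventually.of_forall fun ω => ?_
    rw [norm_mul]
    exact mul_le_mul_of_nonneg_right (h.norm_coe_le_norm _) (norm_nonneg _)
  · filter_upwards [hW] with ω hω
    exact ((h.continuous.tendsto _).comp hω).mul_const _

/-- The model case: binary truncation on `[0, 1)`. It identifies the limit of the Riemann sums with
Lebesgue measure. -/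
lemma dyadicSplit_floor (n : ℕ) :
    DyadicSplit (volume.restrict (Set.Ico (0 : ℝ) 1)) (fun _ => 1) n
      (fun t => ⌊t * 2 ^ n⌋₊) := by
  have h2 : (0 : ℝ) < 2 ^ n := by positivity
  have hm : Measurable fun t : ℝ => ⌊t * 2 ^ n⌋₊ := Nat.measurable_floor.comp (by fun_prop)
  refine ⟨hm, ?_, fun l hl => ?_⟩
  · refine (ae_restrict_iff' measurableSet_Ico).2 (Eventually.of_forall fun t ht => ?_)
    rw [Nat.floor_lt (mul_nonneg ht.1 h2.le)]
    push_cast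
    nlinarith [ht.2]
  · have : ((fun t : ℝ => ⌊t * 2 ^ n⌋₊) ⁻¹' {l}) ∩ Set.Ico 0 1 =
        Set.Ico ((l : ℝ) / 2 ^ n) ((l + 1) / 2 ^ n) := by
      have hl' : (l : ℝ) + 1 ≤ 2 ^ n := by exact_mod_cast hl
      ext t
      simp only [Set.mem_inter_iff, Set.mem_preimage, Set.mem_singleton_iff, Set.mem_Ico,
        div_le_iff₀ h2, lt_div_iff₀ h2]
      constructor
      · rintro ⟨h, h0, -⟩
        exact (Nat.floor_eq_iff (mul_nonneg h0 h2.le)).1 h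
      · rintro ⟨h3, h4⟩
        have h0 : 0 ≤ t * 2 ^ n := l.cast_nonneg.trans h3
        refine ⟨(Nat.floor_eq_iff h0).2 ⟨h3, h4⟩, nonneg_of_mul_nonneg_left h0 h2, ?_⟩
        exact lt_of_mul_lt_mul_right (by linarith) h2.le
    rw [Measure.restrict_restrict (hm (measurableSet_singleton l)), this]
    simp
    rw [← sub_div, add_sub_cancel_left, one_div, max_eq_left (by positivity)]

/-- Tested against a bounded continuous function, both measures are limits of the same Riemann sums,
up to the factor `∫ F`. -/
lemma DyadicSplit.measure_map_eq {P : Measure Ω} {F : Ω → ℝ} {f : ℕ → Ω → ℕ}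
    (hf : ∀ n, DyadicSplit P F n (f n)) (hF : Integrable F P) (hF0 : 0 ≤ F) {W : Ω → ℝ}
    (hWm : Measurable W)
    (hW : ∀ᵐ ω ∂P, Tendsto (fun n => (f n ω : ℝ) / 2 ^ n) atTop (𝓝 (W ω))) :
    (P.withDensity fun ω => ENNReal.ofReal (F ω)).map W =
      ENNReal.ofReal (∫ ω, F ω ∂P) • volume.restrict (Set.Ico (0 : ℝ) 1) := by
  have : IsFiniteMeasure (P.withDensity fun ω => ENNReal.ofReal (F ω)) :=
    isFiniteMeasure_withDensity_ofReal hF.2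
  have : IsFiniteMeasure (ENNReal.ofReal (∫ ω, F ω ∂P) • volume.restrict (Set.Ico (0 : ℝ) 1)) :=
    Measure.smul_finite _ ENNReal.ofReal_ne_top
  refine ext_of_forall_integral_eq_of_IsFiniteMeasure fun h => ?_
  have h1 := DyadicSplit.tendsto hf hF hW h
  have h2 := DyadicSplit.tendsto dyadicSplit_floor (integrable_const 1) (W := id)
    ((ae_restrict_iff' measurableSet_Ico).2 (Eventually.of_forall fun t ht => by
      exact (tendsto_nat_floor_mul_div_atTop (R := ℝ) ht.1).comp
        (tendsto_pow_atTop_atTop_of_one_lt (one_lt_two)))) h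
  rw [integral_map hWm.aemeasurable h.continuous.aestronglyMeasurable,
    integral_withDensity_eq_integral_toReal_smul₀ hF.1.aemeasurable.ennreal_ofReal
      (Eventually.of_forall fun _ => ENNReal.ofReal_lt_top),
    integral_smul_measure, ENNReal.toReal_ofReal (integral_nonneg hF0)]
  simp only [integral_const, MeasurableSet.univ, measureReal_restrict_apply, Set.univ_inter,
    Real.volume_real_Ico, sub_zero, zero_le_one, sup_of_le_left, smul_eq_mul, mul_one, id] at h2 ⊢
  rw [mul_comm, ← tendsto_nhds_unique h1 (h2.mul_const _)]
  refine integral_congr_ae (Eventually.of_forall fun ω => ?_)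
  simp only [ENNReal.toReal_ofReal (hF0 ω), mul_comm]

/-- By Lyapunov convexity, the midpoint between the moments of the labels constantly `0` and
constantly `1` is attained. Such a label halves every `F k` on every level set at once. -/
lemma Splits.exists_dyadicSplit_succ {P : Measure Ω} [IsFiniteMeasure P] (hP : Splits P)
    {κ : Type*} [Fintype κ] {F : κ → Ω → ℝ} (hF : ∀ k, Integrable (F k) P) {n : ℕ} {f : Ω → ℕ}
    (hfm : Measurable f) (hlt : ∀ ω, f ω < 2 ^ n) (hf : ∀ k, DyadicSplit P (F k) n f) :
    ∃ f' : Ω → ℕ, Measurable f' ∧ (∀ ω, f' ω < 2 ^ (n + 1)) ∧ (∀ ω, f' ω / 2 = f ω) ∧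
      ∀ k, DyadicSplit P (F k) (n + 1) f' := by
  have hm : ∀ l, MeasurableSet (f ⁻¹' {l}) := fun l => hfm (measurableSet_singleton l)
  let G : κ × Fin (2 ^ n) → Fin 2 → Ω → ℝ := fun k j ω =>
    (j : ℝ) * (f ⁻¹' {(k.2 : ℕ)}).indicator (F k.1) ω
  have hG : ∀ k j, Integrable (G k j) P := fun k j =>
    ((hF k.1).indicator (hm _)).const_mul _
  have hconv := (hP.isCompact_convex_labelMoments hG).2
  have h0 : (fun k => ∫ ω, G k 0 ω ∂P) ∈ labelMoments P G :=
    ⟨fun _ => 0, measurable_const, fun _ => rfl⟩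
  have h1 : (fun k => ∫ ω, G k 1 ω ∂P) ∈ labelMoments P G :=
    ⟨fun _ => 1, measurable_const, fun _ => rfl⟩
  obtain ⟨s, hs, hsG⟩ := hconv h0 h1 (a := 1 / 2) (b := 1 / 2) (by norm_num) (by norm_num)
    (by norm_num)
  have hsm : ∀ j, MeasurableSet (s ⁻¹' {j}) := fun j => hs (measurableSet_singleton j)
  have hone : ∀ k, ∀ l < 2 ^ n, ∫ ω in f ⁻¹' {l} ∩ s ⁻¹' {1}, F k ω ∂P =
      (∫ ω, F k ω ∂P) / 2 ^ (n + 1) := by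
    intro k l hl
    have := hsG (k, ⟨l, hl⟩)
    simp only [G, Pi.add_apply, Pi.smul_apply, smul_eq_mul, Fin.val_zero, Nat.cast_zero, zero_mul,
      integral_zero, mul_zero, zero_add, Fin.val_one, Nat.cast_one, one_mul,
      integral_indicator (hm l), (hf k).setIntegral l hl] at this
    rw [pow_succ, ← div_div, ← one_div_mul_eq_div 2, this,
      ← integral_indicator ((hm l).inter (hsm 1))]
    refine integral_congr_ae (Eventually.of_forall fun ω => ?_)
    rw [Set.inter_comm, ← Set.indicator_indicator]
    rcases Fin.exists_fin_two.1 ⟨s ω, rfl⟩ with h | h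
    · simp [Set.indicator, h]
    · simp [Set.indicator, h]
  -- The label `s` is appended as a new last binary digit.
  refine ⟨fun ω => 2 * f ω + s ω, ?_, fun ω => ?_, fun ω => ?_, fun k => ⟨?_, ?_, ?_⟩⟩
  · exact (measurable_from_nat (f := fun l => 2 * l)).comp hfm |>.add
      ((measurable_of_countable fun j : Fin 2 => (j : ℕ)).comp hs)
  · have := hlt ω
    have := (s ω).2
    dsimp only
    omega
  · have := (s ω).2
    dsimp only
    omega
  · exact (measurable_from_nat (f := fun l => 2 * l)).comp hfm |>.add
      ((measurable_of_countable fun j : Fin 2 => (j : ℕ)).comp hs)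
  · refine Eventually.of_forall fun ω => ?_
    have := hlt ω
    have := (s ω).2
    omega
  · intro l hl
    have hl2 : l / 2 < 2 ^ n := by omega
    rcases Nat.mod_two_eq_zero_or_one l with h | h
    · have hset : (fun ω => 2 * f ω + (s ω : ℕ)) ⁻¹' {l} = f ⁻¹' {l / 2} \ s ⁻¹' {1} := by
        ext ω
        have := (s ω).2
        simp only [Set.mem_preimage, Set.mem_singleton_iff, Set.mem_sdiff, Fin.ext_iff,
          Fin.val_one]
        omega
      have hadd := integral_inter_add_sdiff (μ := P) (s := f ⁻¹' {l / 2}) (hsm 1)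
        (hF k).integrableOn
      rw [hone k _ hl2, (hf k).setIntegral _ hl2] at hadd
      rw [hset, ← add_right_inj, hadd, pow_succ]
      ring
    · have hset : (fun ω => 2 * f ω + (s ω : ℕ)) ⁻¹' {l} = f ⁻¹' {l / 2} ∩ s ⁻¹' {1} := by
        ext ω
        have := (s ω).2
        simp only [Set.mem_preimage, Set.mem_singleton_iff, Set.mem_inter_iff, Fin.ext_iff,
          Fin.val_one]
        omega
      rw [hset, hone k _ hl2]

/-- A nonatomic space carries a uniform random variable under which finitely many given integrable
functions have constant conditional mean. -/
theorem Splits.exists_uniform {P : Measure Ω} [IsFiniteMeasure P] (hP : Splits P)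
    {κ : Type*} [Fintype κ] {F : κ → Ω → ℝ} (hF : ∀ k, Integrable (F k) P) :
    ∃ W : Ω → unitInterval, Measurable W ∧ ∀ k, ∀ B, MeasurableSet B →
      ∫ ω in W ⁻¹' B, F k ω ∂P = volume.real B * ∫ ω, F k ω ∂P := by
  -- Positive and negative parts are split separately, because each serves as a density in
  -- `DyadicSplit.measure_map_eq`.
  let F' : κ × Bool → Ω → ℝ := fun k ω => if k.2 then max (F k.1 ω) 0 else max (-F k.1 ω) 0
  have hF' : ∀ k, Integrable (F' k) P := by
    rintro ⟨k, _ | _⟩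
    · exact (hF k).neg_part
    · exact (hF k).pos_part
  have hF'0 : ∀ k, 0 ≤ F' k := by
    rintro ⟨k, _ | _⟩ ω <;> simp [F']
  let S : ℕ → Type _ := fun n =>
    {f : Ω → ℕ // Measurable f ∧ (∀ ω, f ω < 2 ^ n) ∧ ∀ k, DyadicSplit P (F' k) n f}
  have hstep : ∀ n (f : S n), ∃ f' : S (n + 1), ∀ ω, f'.1 ω / 2 = f.1 ω := fun n f => by
    obtain ⟨f', h1, h2, h3, h4⟩ := hP.exists_dyadicSplit_succ hF' f.2.1 f.2.2.1 f.2.2.2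
    exact ⟨⟨f', h1, h2, h4⟩, h3⟩
  choose next hnext using hstep
  let start : S 0 := ⟨fun _ => 0, measurable_const, fun _ => by simp, fun k =>
    ⟨measurable_const, by simp, fun l hl => by
      obtain rfl : l = 0 := by simpa using hl
      simp⟩⟩
  let f : ∀ n, S n := fun n => Nat.rec start (fun n g => next n g) n
  have hf : ∀ n ω, (f (n + 1)).1 ω / 2 = (f n).1 ω := fun n => hnext n (f n)
  let w : ℕ → Ω → ℝ := fun n ω => ((f n).1 ω : ℝ) / 2 ^ n
  have hwm : ∀ n, Measurable (w n) := fun n =>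
    (measurable_from_nat (f := fun l : ℕ => (l : ℝ) / 2 ^ n)).comp (f n).2.1
  have hw0 : ∀ n ω, 0 ≤ w n ω := fun n ω => by positivity
  have hw1 : ∀ n ω, w n ω ≤ 1 := fun n ω => by
    refine div_le_one_of_le₀ ?_ (by positivity)
    exact_mod_cast ((f n).2.2.1 ω).le
  -- Since each stage only appends a digit, the truncations increase to `W`.
  have hmono : ∀ ω, Monotone fun n => w n ω := fun ω => monotone_nat_of_le_succ fun n => by
    have h1 : 2 * (f n).1 ω ≤ (f (n + 1)).1 ω := by have := hf n ω; omega
    have h2 : 2 * ((f n).1 ω : ℝ) ≤ (f (n + 1)).1 ω := by exact_mod_cast h1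
    simp only [w]
    rw [div_le_div_iff₀ (by positivity) (by positivity), pow_succ]
    nlinarith [pow_pos (two_pos (α := ℝ)) n]
  have hbdd : ∀ ω, BddAbove (Set.range fun n => w n ω) := fun ω =>
    ⟨1, by rintro _ ⟨n, rfl⟩; exact hw1 n ω⟩
  let W : Ω → ℝ := fun ω => ⨆ n, w n ω
  have hlim : ∀ ω, Tendsto (fun n => w n ω) atTop (𝓝 (W ω)) := fun ω =>
    tendsto_atTop_ciSup (hmono ω) (hbdd ω)
  have hWm : Measurable W := measurable_of_tendsto_metrizable hwm (tendsto_pi_nhds.2 hlim)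
  have hWI : ∀ ω, W ω ∈ unitInterval := fun ω =>
    ⟨ge_of_tendsto' (hlim ω) fun n => hw0 n ω, le_of_tendsto' (hlim ω) fun n => hw1 n ω⟩
  refine ⟨fun ω => ⟨W ω, hWI ω⟩, hWm.subtype_mk, fun k B hB => ?_⟩
  let B' : Set ℝ := Subtype.val '' B
  have hB' : MeasurableSet B' := measurableSet_Icc.subtype_image hB
  have hpre : (fun ω => (⟨W ω, hWI ω⟩ : unitInterval)) ⁻¹' B = W ⁻¹' B' := by
    ext ω
    exact (Subtype.val_injective.mem_set_image (s := B) (a := ⟨W ω, hWI ω⟩)).symm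
  have hvol : (volume.restrict (Set.Ico (0 : ℝ) 1)).real B' = volume.real B := by
    rw [measureReal_def, measureReal_def, restrict_Ico_eq_restrict_Icc,
      Measure.restrict_apply hB', Set.inter_eq_left.2 (by rintro _ ⟨x, -, rfl⟩; exact x.2)]
    exact congrArg _ (volume_image_subtype_coe measurableSet_Icc B)
  have key : ∀ i, ∫ ω in W ⁻¹' B', F' i ω ∂P = volume.real B * ∫ ω, F' i ω ∂P := by
    intro i
    have h1 := DyadicSplit.measure_map_eq (fun n => (f n).2.2.2 i) (hF' i) (hF'0 i) hWm
      (Eventually.of_forall hlim)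
    have h2 := congrArg (fun m => m B') h1
    simp only [Measure.map_apply hWm hB', withDensity_apply _ (hWm hB'), Measure.smul_apply,
      smul_eq_mul] at h2
    rw [integral_eq_lintegral_of_nonneg_ae (Eventually.of_forall (hF'0 i))
      (hF' i).1.restrict, h2, ENNReal.toReal_mul,
      ENNReal.toReal_ofReal (integral_nonneg (hF'0 i)), mul_comm, ← hvol, measureReal_def]
  have hsplit : ∀ ω, F k ω = F' (k, true) ω - F' (k, false) ω := fun ω => by
    simp only [F', if_true, Bool.false_eq_true, if_false]
    exact (max_zero_sub_max_neg_zero_eq_self _).symm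
  rw [hpre]
  simp_rw [hsplit]
  rw [integral_sub (hF' _).integrableOn (hF' _).integrableOn, integral_sub (hF' _) (hF' _),
    key, key, mul_sub]

end Randomization

/-! ### Discretizing the cube and refining labellings to random vectors -/

section Discretization

variable {d : ℕ}

lemma isCompact_cube : IsCompact (cube d) := by
  have : cube d = (EuclideanSpace.equiv (Fin d) ℝ).symm ''
      (Set.univ.pi fun _ => Set.Icc (0 : ℝ) 1) := by
    ext t
    simp only [cube, Set.mem_ofPred_eq, Set.mem_image, Set.mem_pi, Set.mem_univ, true_imp_iff]
    exact ⟨fun h => ⟨t.ofLp, h, rfl⟩, by rintro ⟨x, hx, rfl⟩; exact hx⟩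
  rw [this]
  exact (isCompact_univ_pi fun _ => isCompact_Icc).image (ContinuousLinearEquiv.continuous _)

lemma measurableSet_cube : MeasurableSet (cube d) := isCompact_cube.measurableSet

lemma zero_mem_cube : (0 : E d) ∈ cube d := fun _ => by simp

lemma ae_mem_cube : ∀ᵐ t ∂(unif d), t ∈ cube d := ae_restrict_mem measurableSet_cube

/-- A continuous partition of unity on the cube, subordinate to the balls of radius `δ` around
the points of a finite set. -/
structure CubePartition (s : Finset (E d)) (δ : ℝ) (χ : s → E d → ℝ) : Prop where
  mem_cube : ∀ j : s, (j : E d) ∈ cube d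
  nonempty : s.Nonempty
  measurable : ∀ j, Measurable (χ j)
  continuousOn : ∀ j, ContinuousOn (χ j) (cube d)
  nonneg : ∀ j t, 0 ≤ χ j t
  le_one : ∀ j t, χ j t ≤ 1
  sum_eq_one : ∀ t ∈ cube d, ∑ j, χ j t = 1
  dist_le : ∀ j t, χ j t ≠ 0 → ‖t - j‖ ≤ δ

lemma exists_cubePartition {δ : ℝ} (hδ : 0 < δ) :
    ∃ (s : Finset (E d)) (χ : s → E d → ℝ), CubePartition s δ χ := by
  obtain ⟨s, hs, hsf, hcov⟩ := (isCompact_cube (d := d)).finite_cover_balls hδ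
  lift s to Finset (E d) using hsf
  let h : s → E d → ℝ := fun j t => max 0 (δ - ‖t - j‖)
  have hc : ∀ j, Continuous (h j) := fun j => by fun_prop
  have h0 : ∀ j t, 0 ≤ h j t := fun j t => le_max_left _ _
  have hpos : ∀ t ∈ cube d, 0 < ∑ j, h j t := fun t ht => by
    obtain ⟨x, hx, hxt⟩ := Set.mem_iUnion₂.1 (hcov ht)
    refine Finset.sum_pos' (fun j _ => h0 j t) ⟨⟨x, hx⟩, Finset.mem_univ _, lt_max_of_lt_right ?_⟩
    rw [mem_ball_iff_norm] at hxt
    linarith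
  -- Normalized tent functions. Off the cube the denominator may vanish; the quotient is then zero
  -- and the bounds persist.
  refine ⟨s, fun j t => h j t / ∑ i, h i t, fun j => hs j.2, ?_, fun j => ?_, fun j => ?_,
    fun j t => ?_, fun j t => ?_, fun t ht => ?_, fun j t ht => ?_⟩
  · obtain ⟨x, hx, -⟩ := Set.mem_iUnion₂.1 (hcov zero_mem_cube)
    exact ⟨x, hx⟩
  · exact (hc j).measurable.div (Finset.measurable_sum _ fun i _ => (hc i).measurable)
  · exact (hc j).continuousOn.div (continuous_finsetSum _ fun i _ => hc i).continuousOn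
      fun t ht => (hpos t ht).ne'
  · exact div_nonneg (h0 j t) (Finset.sum_nonneg fun i _ => h0 i t)
  · exact div_le_one_of_le₀ (Finset.single_le_sum (f := fun i => h i t) (fun i _ => h0 i t)
      (Finset.mem_univ j)) (Finset.sum_nonneg fun i _ => h0 i t)
  · rw [← Finset.sum_div, div_self (hpos t ht).ne']
  · by_contra! hlt
    refine ht ?_
    rw [show h j t = 0 from max_eq_left (by linarith), zero_div]

/-- Any probability law on `E d` is an image of the uniform law on `[0, 1]`. The normalization is
multiplied out so that `ρ = 0` is allowed. -/
lemma exists_measurable_transport (ρ : Measure (E d)) [IsFiniteMeasure ρ] :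
    ∃ S : unitInterval → E d, Measurable S ∧
      ∀ B, MeasurableSet B → volume.real (S ⁻¹' B) * ρ.real Set.univ = ρ.real B := by
  rcases eq_or_ne ρ 0 with rfl | hρ
  · exact ⟨fun _ => 0, measurable_const, fun B _ => by simp⟩
  · have : NeZero ρ := ⟨hρ⟩
    obtain ⟨S, hS, hmap⟩ := Measure.exists_measurable_map_eq ((ρ Set.univ)⁻¹ • ρ)
    refine ⟨S, hS, fun B hB => ?_⟩
    have h0 : ρ.real Set.univ ≠ 0 :=
      ENNReal.toReal_ne_zero.2 ⟨by simpa using hρ, measure_ne_top _ _⟩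
    rw [measureReal_def, ← Measure.map_apply hS hB, hmap]
    simp only [Measure.smul_apply, smul_eq_mul, ENNReal.toReal_mul, ENNReal.toReal_inv,
      ← measureReal_def]
    field_simp

variable {Ω : Type*} [MeasurableSpace Ω] {N : ℕ} {P : Measure Ω} [IsProbabilityMeasure P]
  {X : Ω → E N} {Y : Ω → E d} {s : Finset (E d)} {δ : ℝ} {χ : s → E d → ℝ}

lemma meanIndep_of_setIntegral_eq_zero (hX : Integrable X P) {V : Ω → E d} (hV : Measurable V)
    (h : ∀ B, MeasurableSet B → ∀ i, ∫ ω in V ⁻¹' B, X ω i ∂P = 0) :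
    P[X | MeasurableSpace.comap V inferInstance] =ᵐ[P] 0 := by
  refine (ae_eq_condExp_of_forall_setIntegral_eq hV.comap_le hX
    (fun _ _ _ => integrableOn_zero) ?_ aestronglyMeasurable_zero).symm
  rintro _ ⟨B, hB, rfl⟩ -
  simp only [integral_zero]
  ext i
  have := (EuclideanSpace.proj i : E N →L[ℝ] ℝ).integral_comp_comm (hX.restrict (s := V ⁻¹' B))
  exact (this.symm.trans (h B hB i)).symm

/-- A labelling with the right moments is refined by an admissible random vector. -/
lemma exists_primalAdmissible_near [IsProbabilityMeasure (unif d)] (hP : Splits P)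
    (hX : Integrable X P) (hχ : CubePartition s δ χ) {τ : Ω → s} (hτ : Measurable τ)
    (hw : ∀ j, P.real (τ ⁻¹' {j}) = ∫ t, χ j t ∂(unif d))
    (hτX : ∀ j i, ∫ ω in τ ⁻¹' {j}, X ω i ∂P = 0) :
    ∃ V, PrimalAdmissible P X V ∧ ∀ᵐ ω ∂P, ‖V ω - (τ ω : E d)‖ ≤ δ := by
  have hτm : ∀ j, MeasurableSet (τ ⁻¹' {j}) := fun j => hτ (measurableSet_singleton j)
  have hXi : ∀ i, Integrable (fun ω => X ω i) P := fun i =>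
    (EuclideanSpace.proj i : E N →L[ℝ] ℝ).integrable_comp hX
  have hχi : ∀ j, Integrable (χ j) (unif d) := fun j =>
    Integrable.of_bound (hχ.measurable j).aestronglyMeasurable 1
      (Filter.Eventually.of_forall fun t => by
        rw [Real.norm_eq_abs, abs_of_nonneg (hχ.nonneg j t)]; exact hχ.le_one j t)
  -- `none` tracks the mass of a piece and `some i` the coordinate `X i` on it, so on each piece of
  -- positive mass `W` is uniform and `X` has mean zero given `W`.
  let F : s × Option (Fin N) → Ω → ℝ := fun k =>
    (τ ⁻¹' {k.1}).indicator fun ω => k.2.elim 1 (X ω)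
  have hF : ∀ k, Integrable (F k) P := by
    rintro ⟨j, _ | i⟩
    · exact (integrable_const (1 : ℝ)).indicator (hτm j)
    · exact (hXi i).indicator (hτm j)
  obtain ⟨W, hW, hWF⟩ := hP.exists_uniform hF
  let ρ : s → Measure (E d) := fun j => (unif d).withDensity fun t => ENNReal.ofReal (χ j t)
  have hρfin : ∀ j, IsFiniteMeasure (ρ j) := fun j => isFiniteMeasure_withDensity_ofReal (hχi j).2
  have hρ : ∀ j B, MeasurableSet B → (ρ j).real B = ∫ t in B, χ j t ∂(unif d) := fun j B hB => by
    rw [measureReal_def, withDensity_apply _ hB, integral_eq_lintegral_of_nonneg_ae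
      (Filter.Eventually.of_forall (hχ.nonneg j)) (hχ.measurable j).aestronglyMeasurable]
  choose S hS hSρ using fun j => exists_measurable_transport (ρ j)
  -- On piece `j` the image of `P` under `V` is `ρ j`, which lives within `δ` of `j`; these measures
  -- add up to `unif d` because the `χ j` sum to one.
  let V : Ω → E d := fun ω => S (τ ω) (W ω)
  have hV : Measurable V :=
    (measurable_from_prod_countable_right (f := fun z : s × unitInterval => S z.1 z.2) hS).comp
      (hτ.prodMk hW)
  have hpiece : ∀ j B, τ ⁻¹' {j} ∩ V ⁻¹' B = W ⁻¹' (S j ⁻¹' B) ∩ τ ⁻¹' {j} := fun j B => by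
    ext ω
    simp only [Set.mem_inter_iff, Set.mem_preimage, Set.mem_singleton_iff, V]
    constructor
    · rintro ⟨rfl, h⟩; exact ⟨h, rfl⟩
    · rintro ⟨h, rfl⟩; exact ⟨rfl, h⟩
  have hWj : ∀ j B, MeasurableSet B → ∀ k : Option (Fin N), ∫ ω in τ ⁻¹' {j} ∩ V ⁻¹' B, k.elim 1 (X ω) ∂P =
      volume.real (S j ⁻¹' B) * ∫ ω in τ ⁻¹' {j}, k.elim 1 (X ω) ∂P := fun j B hB k => by
    have := hWF (j, k) _ (hS j hB)
    rwa [setIntegral_indicator (hτm j), integral_indicator (hτm j), ← hpiece] at this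
  have hmass : ∀ j B, MeasurableSet B → P.real (τ ⁻¹' {j} ∩ V ⁻¹' B) = (ρ j).real B :=
    fun j B hB => by
      have := hWj j B hB none
      simp only [Option.elim_none, integral_const, smul_eq_mul, mul_one,
        measureReal_restrict_apply_univ] at this
      rw [this, hw, ← hSρ j B hB, hρ j _ MeasurableSet.univ, setIntegral_univ]
  have hunion : ∀ B, V ⁻¹' B = ⋃ j, τ ⁻¹' {j} ∩ V ⁻¹' B := fun B => by
    rw [← Set.iUnion_inter, ← Set.preimage_iUnion, Set.iUnion_of_singleton, Set.preimage_univ,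
      Set.univ_inter]
  have hdisj : ∀ B, Pairwise (Function.onFun Disjoint fun j => τ ⁻¹' {j} ∩ V ⁻¹' B) :=
    fun B i j hij => Disjoint.mono Set.inter_subset_left Set.inter_subset_left
      (Disjoint.preimage _ (Set.disjoint_singleton.2 hij))
  have hmeasB : ∀ B, MeasurableSet B → ∀ j, MeasurableSet (τ ⁻¹' {j} ∩ V ⁻¹' B) :=
    fun B hB j => (hτm j).inter (hV hB)
  refine ⟨V, ⟨hV, ?_, meanIndep_of_setIntegral_eq_zero hX hV fun B hB i => ?_⟩, ?_⟩
  · ext B hB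
    rw [Measure.map_apply hV hB, ← ENNReal.toReal_eq_toReal_iff' (measure_ne_top _ _)
      (measure_ne_top _ _), ← measureReal_def, ← measureReal_def, hunion,
      measureReal_iUnion_fintype (hdisj B) (hmeasB B hB)]
    simp_rw [hmass _ B hB, hρ _ B hB]
    rw [← integral_finsetSum _ fun j _ => (hχi j).integrableOn]
    rw [setIntegral_congr_ae (g := fun _ => (1 : ℝ)) hB ?_]
    · simp
    · filter_upwards [ae_mem_cube (d := d)] with t ht _ using hχ.sum_eq_one t ht
  · rw [hunion, integral_iUnion_fintype (hmeasB B hB) (hdisj B) fun j => (hXi i).integrableOn]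
    refine Finset.sum_eq_zero fun j _ => ?_
    have := hWj j B hB (some i)
    simp only [Option.elim_some] at this
    rw [this, hτX, mul_zero]
  · have hbad : ∀ j, ∀ᵐ ω ∂P, ω ∉ τ ⁻¹' {j} ∩ V ⁻¹' {t | δ < ‖t - (j : E d)‖} := fun j => by
      have hm : MeasurableSet {t : E d | δ < ‖t - j‖} :=
        measurableSet_lt measurable_const (by fun_prop)
      rw [← measure_eq_zero_iff_ae_notMem, ← measureReal_eq_zero_iff, hmass j _ hm, hρ j _ hm]
      refine setIntegral_eq_zero_of_forall_eq_zero fun t ht => ?_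
      by_contra h
      exact (hχ.dist_le j t h).not_gt ht
    filter_upwards [ae_all_iff.2 hbad] with ω h
    by_contra! hlt
    exact h (τ ω) ⟨rfl, hlt⟩

end Discretization

/-! ### Multipliers for the discretized problem -/

section Duality

variable {d N : ℕ} {Ω : Type*} [MeasurableSpace Ω] {P : Measure Ω} [IsProbabilityMeasure P]
  {X : Ω → E N} {Y : Ω → E d} {U : Ω → E d} {s : Finset (E d)} {δ : ℝ} {χ : s → E d → ℝ}

lemma norm_le_of_mem_cube : ∃ C, ∀ t ∈ cube d, ‖t‖ ≤ C :=
  (isCompact_cube (d := d)).isBounded.exists_norm_le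

omit [IsProbabilityMeasure P] in
lemma PrimalAdmissible.ae_mem_cube (hU : PrimalAdmissible P X U) : ∀ᵐ ω ∂P, U ω ∈ cube d := by
  have h := VQR.ae_mem_cube (d := d)
  rw [← hU.law] at h
  exact ae_of_ae_map hU.measurable.aemeasurable h

omit [IsProbabilityMeasure P] in
lemma PrimalAdmissible.integrable_inner (hU : PrimalAdmissible P X U) (hY : Integrable Y P) :
    Integrable (fun ω => inner ℝ (U ω) (Y ω)) P := by
  obtain ⟨C, hC⟩ := norm_le_of_mem_cube (d := d)
  refine (hY.norm.const_mul C).mono' (hU.measurable.aestronglyMeasurable.inner hY.1) ?_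
  filter_upwards [hU.ae_mem_cube] with ω hω
  exact (norm_inner_le_norm _ _).trans (mul_le_mul_of_nonneg_right (hC _ hω) (norm_nonneg _))

omit [IsProbabilityMeasure P] in
lemma integrable_inner_label (hY : Integrable Y P) {τ : Ω → s} (hτ : Measurable τ) :
    Integrable (fun ω => inner ℝ (τ ω : E d) (Y ω)) P := by
  have hm : Measurable fun ω => (τ ω : E d) := measurable_subtype_coe.comp hτ
  refine (hY.norm.const_mul (∑ j : s, ‖(j : E d)‖)).mono'
    (hm.aestronglyMeasurable.inner hY.1) (Filter.Eventually.of_forall fun ω => ?_)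
  refine (norm_inner_le_norm _ _).trans (mul_le_mul_of_nonneg_right ?_ (norm_nonneg _))
  exact Finset.single_le_sum (f := fun j : s => ‖(j : E d)‖) (fun _ _ => norm_nonneg _)
    (Finset.mem_univ (τ ω))

/-- The value of an admissible labelling is at most the primal value, up to the mesh size. -/
lemma SolvesPrimal.label_le [IsProbabilityMeasure (unif d)] (hP : Splits P)
    (hX : Integrable X P) (hY : Integrable Y P) (hU : SolvesPrimal P X Y U)
    (hχ : CubePartition s δ χ) {τ : Ω → s} (hτ : Measurable τ)
    (hw : ∀ j, P.real (τ ⁻¹' {j}) = ∫ t, χ j t ∂(unif d))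
    (hτX : ∀ j i, ∫ ω in τ ⁻¹' {j}, X ω i ∂P = 0) :
    ∫ ω, inner ℝ (τ ω : E d) (Y ω) ∂P ≤ ∫ ω, inner ℝ (U ω) (Y ω) ∂P + δ * ∫ ω, ‖Y ω‖ ∂P := by
  obtain ⟨V, hV, hVτ⟩ := exists_primalAdmissible_near hP hX hχ hτ hw hτX
  have h1 : ∫ ω, inner ℝ (τ ω : E d) (Y ω) ∂P ≤
      ∫ ω, (inner ℝ (V ω) (Y ω) + δ * ‖Y ω‖) ∂P := by
    refine integral_mono_ae (integrable_inner_label hY hτ)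
      ((hV.integrable_inner hY).add (hY.norm.const_mul δ)) ?_
    filter_upwards [hVτ] with ω hω
    have h2 : inner ℝ ((τ ω : E d) - V ω) (Y ω) ≤ δ * ‖Y ω‖ :=
      (real_inner_le_norm _ _).trans
        (mul_le_mul_of_nonneg_right (by rwa [norm_sub_rev]) (norm_nonneg _))
    rw [inner_sub_left] at h2
    linarith
  rw [integral_add (hV.integrable_inner hY) (hY.norm.const_mul δ), integral_const_mul] at h1
  exact h1.trans (add_le_add_left (hU.optimal V hV) _)

/-- The moment functions of the discretized problem: masses of the pieces, means of `X` on the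
pieces, and the correlation with `Y`. -/
def discreteMoment (X : Ω → E N) (Y : Ω → E d) (s : Finset (E d)) :
    (s ⊕ (s × Fin N)) ⊕ Unit → s → Ω → ℝ
  | Sum.inl (Sum.inl i), j, _ => if i = j then 1 else 0
  | Sum.inl (Sum.inr i), j, ω => if i.1 = j then X ω i.2 else 0
  | Sum.inr _, j, ω => inner ℝ (j : E d) (Y ω)

lemma integrable_discreteMoment (hX : Integrable X P) (hY : Integrable Y P) (k) (j : s) :
    Integrable (discreteMoment X Y s k j) P := by
  have hXi : ∀ i, Integrable (fun ω => X ω i) P := fun i =>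
    (EuclideanSpace.proj i : E N →L[ℝ] ℝ).integrable_comp hX
  rcases k with (i | ⟨i, l⟩) | u
  · exact integrable_const _
  · change Integrable (fun ω => if i = j then X ω l else 0) P
    split_ifs
    · exact hXi l
    · exact integrable_zero _ _ _
  · exact hY.const_inner _

/-- Strong duality for the discretized problem, as an inequality for every labelling. -/
lemma SolvesPrimal.exists_multipliers [IsProbabilityMeasure (unif d)] (hP : Splits P)
    (hX : Integrable X P) (hX0 : ∫ ω, X ω ∂P = 0) (hY : Integrable Y P)
    (hU : SolvesPrimal P X Y U) (hχ : CubePartition s δ χ) {ε : ℝ} (hε : 0 < ε) :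
    ∃ (α : s → ℝ) (β : s → E N), ∀ τ : Ω → s, Measurable τ →
      ∫ ω, (inner ℝ (τ ω : E d) (Y ω) - α (τ ω) - inner ℝ (β (τ ω)) (X ω)) ∂P +
        ∑ j, α j * ∫ t, χ j t ∂(unif d) ≤
      ∫ ω, inner ℝ (U ω) (Y ω) ∂P + δ * ∫ ω, ‖Y ω‖ ∂P + ε := by
  classical
  set v := ∫ ω, inner ℝ (U ω) (Y ω) ∂P + δ * ∫ ω, ‖Y ω‖ ∂P
  let w : s → ℝ := fun j => ∫ t, χ j t ∂(unif d)
  have : Nonempty s := hχ.nonempty.to_subtype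
  let F := discreteMoment X Y s
  have hF : ∀ k j, Integrable (F k j) P := integrable_discreteMoment hX hY
  have hXi : ∀ i, ∫ ω, X ω i ∂P = 0 := fun i => by
    have := (EuclideanSpace.proj i : E N →L[ℝ] ℝ).integral_comp_comm hX
    rw [hX0, map_zero] at this
    exact this
  obtain ⟨hKc, hKconv⟩ := hP.isCompact_convex_labelMoments hF
  -- The moment vector of a feasible labelling with correlation `r`.
  let p : ℝ → (s ⊕ (s × Fin N)) ⊕ Unit → ℝ := fun r => Sum.elim (Sum.elim w fun _ => 0) fun _ => r
  have hle : ∀ r, p r ∈ labelMoments P F → r ≤ v := by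
    rintro r ⟨τ, hτ, hr⟩
    have hm : ∀ j, MeasurableSet (τ ⁻¹' {j}) := fun j => hτ (measurableSet_singleton j)
    have h1 := hr (Sum.inr ())
    simp only [p, F, discreteMoment, Sum.elim_inr] at h1
    rw [h1]
    refine hU.label_le hP hX hY hχ hτ (fun j => ?_) fun j i => ?_
    · have h2 := hr (Sum.inl (Sum.inl j))
      simp only [p, F, discreteMoment, Sum.elim_inl] at h2
      refine Eq.trans ?_ h2.symm
      rw [← integral_indicator_one (hm j)]
      refine integral_congr_ae (Filter.Eventually.of_forall fun ω => ?_)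
      simp [Set.indicator, eq_comm]
    · have h2 := hr (Sum.inl (Sum.inr (j, i)))
      simp only [p, F, discreteMoment, Sum.elim_inl, Sum.elim_inr] at h2
      refine Eq.trans ?_ h2.symm
      rw [← integral_indicator (hm j)]
      refine integral_congr_ae (Filter.Eventually.of_forall fun ω => ?_)
      simp [Set.indicator, eq_comm]
  have hw0 : ∀ j, 0 ≤ w j := fun j => integral_nonneg (hχ.nonneg j)
  have hw1 : ∑ j, w j = 1 := by
    have hχi : ∀ j, Integrable (χ j) (unif d) := fun j =>
      Integrable.of_bound (hχ.measurable j).aestronglyMeasurable 1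
        (Filter.Eventually.of_forall fun t => by
          rw [Real.norm_eq_abs, abs_of_nonneg (hχ.nonneg j t)]; exact hχ.le_one j t)
    rw [← integral_finsetSum _ fun j _ => hχi j]
    rw [integral_congr_ae (g := fun _ => (1 : ℝ))]
    · simp
    · filter_upwards [VQR.ae_mem_cube (d := d)] with t ht using hχ.sum_eq_one t ht
  -- A feasible value, from averaging the constant labellings with weights `w`; the means of `X`
  -- vanish because `𝔼 X = 0`.
  let r₀ : ℝ := ∑ j, w j * ∫ ω, inner ℝ (j : E d) (Y ω) ∂P
  have hr₀ : p r₀ ∈ labelMoments P F := by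
    have hmem := hKconv.sum_mem (t := Finset.univ) (w := w)
      (z := fun j k => ∫ ω, F k j ω ∂P) (fun j _ => hw0 j) hw1
      fun j _ => ⟨fun _ => j, measurable_const, fun _ => rfl⟩
    convert hmem using 1
    ext k
    rw [Finset.sum_apply]
    rcases k with (i | ⟨i, l⟩) | u
    · simp [p, F, discreteMoment]
    · simp only [p, F, discreteMoment, Sum.elim_inl, Sum.elim_inr, Pi.smul_apply, smul_eq_mul]
      refine (Finset.sum_eq_zero fun j _ => ?_).symm
      split_ifs <;> simp [hXi]
    · simp [p, F, discreteMoment, r₀]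
  obtain ⟨f, u, hfu, huf⟩ := geometric_hahn_banach_closed_point hKconv hKc.isClosed
    (x := p (v + ε)) fun h => by linarith [hle _ h]
  obtain ⟨c, hf⟩ : ∃ c : (s ⊕ (s × Fin N)) ⊕ Unit → ℝ, ∀ x, f x = ∑ k, x k * c k :=
    ⟨_, fun x => LinearMap.pi_apply_eq_sum_univ f.toLinearMap x⟩
  have hfp : ∀ r, f (p r) = ∑ j, w j * c (Sum.inl (Sum.inl j)) + r * c (Sum.inr ()) := fun r => by
    rw [hf]
    simp [Fintype.sum_sum_type, p]
  set σ := c (Sum.inr ())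
  -- The separating hyperplane is not vertical, as `p r₀` and `p (v + ε)` lie on opposite sides and
  -- differ only in the correlation. Dividing by `σ` then gives that coordinate weight one.
  have hσ : 0 < σ := by
    have h1 := (hfu _ hr₀).trans huf
    rw [hfp, hfp] at h1
    have h2 : 0 < (v + ε - r₀) * σ := by linarith
    exact (pos_iff_pos_of_mul_pos h2).1 (by linarith [hle _ hr₀])
  refine ⟨fun j => -(c (Sum.inl (Sum.inl j)) / σ),
    fun j => WithLp.toLp 2 fun i => -(c (Sum.inl (Sum.inr (j, i))) / σ), fun τ hτ => ?_⟩
  have hFτ : ∀ k, Integrable (fun ω => F k (τ ω) ω) P := by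
    intro k
    have : (fun ω => F k (τ ω) ω) =
        fun ω => ∑ j, (τ ⁻¹' {j}).indicator (F k j) ω := by
      ext ω
      rw [Finset.sum_eq_single (τ ω)]
      · rw [Set.indicator_of_mem (by simp)]
      · intro j _ hj
        exact Set.indicator_of_notMem (s := τ ⁻¹' {j}) (fun h : τ ω = j => hj h.symm) _
      · simp
    rw [this]
    exact integrable_finsetSum _ fun j _ =>
      (hF k j).indicator (hτ (measurableSet_singleton j))
  have h1 := (hfu _ ⟨τ, hτ, fun _ => rfl⟩).trans huf
  rw [hfp, hf] at h1
  simp_rw [← integral_mul_const] at h1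
  rw [← integral_finsetSum _ fun k _ => (hFτ k).mul_const _] at h1
  have h2 : ∀ ω, ∑ k, F k (τ ω) ω * c k = σ * (inner ℝ (τ ω : E d) (Y ω) -
      -(c (Sum.inl (Sum.inl (τ ω))) / σ) -
      inner ℝ (WithLp.toLp 2 fun i => -(c (Sum.inl (Sum.inr (τ ω, i))) / σ) : E N) (X ω)) := by
    intro ω
    have h3 : inner ℝ (WithLp.toLp 2 fun i => -(c (Sum.inl (Sum.inr (τ ω, i))) / σ) : E N) (X ω) =
        -((∑ i, X ω i * c (Sum.inl (Sum.inr (τ ω, i)))) / σ) := by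
      simp only [PiLp.inner_apply, RCLike.inner_apply, conj_trivial, mul_neg,
        Finset.sum_neg_distrib, Finset.sum_div, mul_div_assoc]
    rw [h3]
    simp only [Fintype.sum_sum_type, Fintype.sum_prod_type, F, discreteMoment, ite_mul, one_mul,
      zero_mul, Finset.sum_ite_eq', Finset.mem_univ, if_true, Finset.univ_unique,
      Finset.sum_singleton]
    rw [Finset.sum_eq_single (τ ω) (fun j _ hj => by simp [hj]) (by simp)]
    simp only [if_true]
    field_simp
    ring_nf
    rfl
  simp_rw [h2] at h1
  rw [integral_const_mul] at h1
  have h4 : ∑ j, w j * c (Sum.inl (Sum.inl j)) =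
      -(σ * ∑ j, -(c (Sum.inl (Sum.inl j)) / σ) * w j) := by
    rw [Finset.mul_sum, ← Finset.sum_neg_distrib]
    refine Finset.sum_congr rfl fun j _ => ?_
    field_simp
  rw [h4] at h1
  refine le_of_lt (lt_of_mul_lt_mul_left ?_ hσ.le)
  rw [mul_add]
  linarith

end Duality

/-! ### No duality gap, and saturation of the dual constraint -/

section ComplementarySlackness

variable {d N : ℕ} {Ω : Type*} [MeasurableSpace Ω] {P : Measure Ω} [IsProbabilityMeasure P]
  {X : Ω → E N} {Y : Ω → E d} {U : Ω → E d}

/-- There are continuous admissible triples with cost arbitrarily close to the primal value. -/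
lemma SolvesPrimal.exists_contDualAdmissible [IsProbabilityMeasure (unif d)] (hP : Splits P)
    (hXm : Measurable X) (hYm : Measurable Y)
    (hX : Integrable X P) (hX0 : ∫ ω, X ω ∂P = 0) (hY : Integrable Y P)
    (hU : SolvesPrimal P X Y U) {δ : ℝ} (hδ : 0 < δ) {ε : ℝ} (hε : 0 < ε) :
    ∃ ψ φ b, ContDualAdmissible (P.map fun ω => (X ω, Y ω)) ψ φ b ∧
      dualCost (P.map fun ω => (X ω, Y ω)) ψ φ ≤
        ∫ ω, inner ℝ (U ω) (Y ω) ∂P + 2 * δ * ∫ ω, ‖Y ω‖ ∂P + ε := by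
  obtain ⟨s, χ, hχ⟩ := exists_cubePartition (d := d) hδ
  obtain ⟨α, β, hαβ⟩ := hU.exists_multipliers hP hX hX0 hY hχ hε
  have : Nonempty s := hχ.nonempty.to_subtype
  let ℓ : s → E N × E d → ℝ := fun j z => inner ℝ (j : E d) z.2 - α j - inner ℝ (β j) z.1
  have hℓc : ∀ j, Continuous (ℓ j) := fun j => by fun_prop
  let ψ : E N × E d → ℝ := fun z => Finset.univ.sup' Finset.univ_nonempty fun j => ℓ j z
  have hψc : Continuous ψ := Continuous.finset_sup'_apply _ fun j _ => hℓc j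
  have hXY : Measurable fun ω => (X ω, Y ω) := hXm.prodMk hYm
  -- A maximizing label turns the integral of `ψ` into the labelling integral bounded by the
  -- multiplier inequality.
  obtain ⟨τ, hτ, hsel⟩ := exists_measurable_selection
    (p := fun ω (j : s) => ℓ j (X ω, Y ω) = ψ (X ω, Y ω)) fun j =>
      measurableSet_eq_fun ((hℓc j).measurable.comp hXY) (hψc.measurable.comp hXY)
  have hψτ : ∀ ω, ψ (X ω, Y ω) = ℓ (τ ω) (X ω, Y ω) := fun ω => by
    obtain ⟨j, -, hj⟩ := Finset.exists_mem_eq_sup' (Finset.univ_nonempty (α := s))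
      fun j => ℓ j (X ω, Y ω)
    exact (hsel ω ⟨j, hj.symm⟩).symm
  have hℓi : ∀ j, Integrable (fun ω => ℓ j (X ω, Y ω)) P := fun j =>
    ((hY.const_inner _).sub (integrable_const _)).sub (hX.const_inner _)
  have hψi : Integrable (fun ω => ψ (X ω, Y ω)) P := by
    refine (integrable_finsetSum Finset.univ fun j _ => (hℓi j).norm).mono'
      (hψc.measurable.comp hXY).aestronglyMeasurable (Filter.Eventually.of_forall fun ω => ?_)
    rw [hψτ]
    exact Finset.single_le_sum (f := fun j => ‖ℓ j (X ω, Y ω)‖) (fun _ _ => norm_nonneg _)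
      (Finset.mem_univ (τ ω))
  have hψi' : Integrable (fun ω => ψ (X ω, Y ω) + δ * ‖Y ω‖) P := hψi.add (hY.norm.const_mul δ)
  have hψ'c : Continuous fun z : E N × E d => ψ z + δ * ‖z.2‖ := by fun_prop
  have hχi : ∀ j, Integrable (χ j) (unif d) := fun j =>
    Integrable.of_bound (hχ.measurable j).aestronglyMeasurable 1
      (Filter.Eventually.of_forall fun t => by
        rw [Real.norm_eq_abs, abs_of_nonneg (hχ.nonneg j t)]; exact hχ.le_one j t)
  -- The multipliers are interpolated by `χ`. The term `δ * ‖y‖` pays for replacing `t` by a node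
  -- `j` within `δ`, and is the second `δ` in the cost.
  refine ⟨fun z => ψ z + δ * ‖z.2‖, fun t => ∑ j, α j * χ j t, fun t => ∑ j, χ j t • β j,
    ⟨hψ'c.continuousOn, ?_, ?_, ?_, ?_⟩, ?_⟩
  · exact (integrable_map_measure hψ'c.aestronglyMeasurable hXY.aemeasurable).2 hψi'
  · exact continuousOn_finsetSum _ fun j _ => continuousOn_const.mul (hχ.continuousOn j)
  · exact continuousOn_finsetSum _ fun j _ => (hχ.continuousOn j).smul continuousOn_const
  · intro x y _ t ht
    have h1 : ∀ j, χ j t * inner ℝ t y ≤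
        χ j t * (ψ (x, y) + δ * ‖y‖) + α j * χ j t + χ j t * inner ℝ (β j) x := fun j => by
      rcases (hχ.nonneg j t).eq_or_lt with h0 | hpos
      · rw [← h0]; simp
      · have h2 : inner ℝ (t - j) y ≤ δ * ‖y‖ := (real_inner_le_norm _ _).trans
          (mul_le_mul_of_nonneg_right (hχ.dist_le j t hpos.ne') (norm_nonneg _))
        have h3 : ℓ j (x, y) ≤ ψ (x, y) :=
          Finset.le_sup' (fun j => ℓ j (x, y)) (Finset.mem_univ j)
        rw [inner_sub_left] at h2
        simp only [ℓ] at h3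
        nlinarith
    have h2 := Finset.sum_le_sum fun j (_ : j ∈ Finset.univ) => h1 j
    rw [← Finset.sum_mul, Finset.sum_add_distrib, Finset.sum_add_distrib, ← Finset.sum_mul,
      hχ.sum_eq_one t ht, one_mul, one_mul] at h2
    rw [sum_inner]
    simpa only [real_inner_smul_left] using h2
  · have h1 := hαβ τ hτ
    rw [dualCost, integral_map hXY.aemeasurable hψ'c.aestronglyMeasurable,
      integral_finsetSum _ fun j _ => (hχi j).const_mul _]
    simp only [integral_const_mul]
    rw [integral_add hψi (hY.norm.const_mul δ), integral_const_mul, integral_congr_ae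
      (Filter.Eventually.of_forall hψτ)]
    simp only [ℓ]
    linarith

/-- There is no duality gap. -/
theorem SolvesPrimal.dualCost_le [IsProbabilityMeasure (unif d)] (hP : Splits P)
    (hXm : Measurable X) (hYm : Measurable Y)
    (hX : Integrable X P) (hX0 : ∫ ω, X ω ∂P = 0) (hY : Integrable Y P)
    (hU : SolvesPrimal P X Y U) {ψ : E N × E d → ℝ} {φ : E d → ℝ} {b : E d → E N}
    (hdual : SolvesDual (P.map fun ω => (X ω, Y ω)) ψ φ b) :
    dualCost (P.map fun ω => (X ω, Y ω)) ψ φ ≤ ∫ ω, inner ℝ (U ω) (Y ω) ∂P := by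
  refine le_of_forall_pos_le_add fun ε hε => ?_
  have hY0 : 0 ≤ ∫ ω, ‖Y ω‖ ∂P := integral_nonneg fun _ => norm_nonneg _
  set m := ∫ ω, ‖Y ω‖ ∂P
  -- With this mesh `2 * δ * m ≤ ε / 2`; the `+ 1` covers `m = 0`.
  obtain ⟨ψ', φ', b', hadm, hcost⟩ := hU.exists_contDualAdmissible hP hXm hYm hX hX0 hY
    (δ := ε / (4 * (m + 1))) (by positivity) (half_pos hε)
  have h1 := (hdual.optimal ψ' φ' b' hadm).trans hcost
  have h2 : 2 * (ε / (4 * (m + 1))) * m ≤ ε / 2 := by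
    rw [mul_div_assoc', div_mul_eq_mul_div, div_le_div_iff₀ (by positivity) two_pos]
    nlinarith
  linarith

/-- Bounded functions of `V` are uncorrelated with `X` when `X` is mean-independent of `V`. -/
lemma PrimalAdmissible.setIntegral_inner_eq_zero (hX : Integrable X P)
    (hU : PrimalAdmissible P X U) {b : E d → E N} (hb : StronglyMeasurable b) (n : ℕ) :
    IntegrableOn (fun ω => inner ℝ (b (U ω)) (X ω)) {ω | ‖b (U ω)‖ ≤ n} P ∧
      ∫ ω in {ω | ‖b (U ω)‖ ≤ n}, inner ℝ (b (U ω)) (X ω) ∂P = 0 := by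
  let g : Ω → E N := fun ω => {t | ‖b t‖ ≤ n}.indicator b (U ω)
  have hbn : MeasurableSet {t | ‖b t‖ ≤ n} := hb.norm.measurable measurableSet_Iic
  have hA : MeasurableSet {ω | ‖b (U ω)‖ ≤ n} := hU.measurable hbn
  have hg : StronglyMeasurable[MeasurableSpace.comap U inferInstance] g :=
    (hb.indicator hbn).comp_measurable (comap_measurable U)
  have hgb : ∀ ω, ‖g ω‖ ≤ n := fun ω => by
    by_cases h : ‖b (U ω)‖ ≤ n
    · simp [g, Set.indicator, h]
    · simp [g, Set.indicator, h]
  have hgX : Integrable (fun ω => inner ℝ (g ω) (X ω)) P := by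
    refine (hX.norm.const_mul n).mono'
      ((hg.mono hU.measurable.comap_le).aestronglyMeasurable.inner hX.1)
      (Filter.Eventually.of_forall fun ω => ?_)
    exact (norm_inner_le_norm _ _).trans (mul_le_mul_of_nonneg_right (hgb ω) (norm_nonneg _))
  have heq : (fun ω => inner ℝ (g ω) (X ω)) =
      {ω | ‖b (U ω)‖ ≤ n}.indicator fun ω => inner ℝ (b (U ω)) (X ω) := by
    ext ω
    by_cases h : ‖b (U ω)‖ ≤ n
    · simp [g, Set.indicator, h]
    · simp [g, Set.indicator, h]
  -- The truncated `b(U)` is bounded and `U`-measurable, so it can be pulled out of the conditional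
  -- expectation of `X`, which is zero.
  have hpull := condExp_bilin_of_stronglyMeasurable_left (innerSL ℝ) hg hgX hX
  have hzero : ∫ ω, inner ℝ (g ω) (X ω) ∂P = 0 := by
    rw [← integral_condExp hU.measurable.comap_le]
    refine integral_eq_zero_of_ae ?_
    filter_upwards [hpull, hU.meanIndep] with ω h1 h2
    refine h1.trans ?_
    rw [h2]
    simp
  rw [heq] at hgX hzero
  exact ⟨(integrable_indicator_iff hA).1 hgX, by rwa [integral_indicator hA] at hzero⟩

omit [IsProbabilityMeasure P] in
/-- A nonnegative function is null if its integrals over an exhausting sequence have a nonpositive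
limit. -/
lemma ae_eq_zero_of_setIntegral_le {f : Ω → ℝ} (hf : 0 ≤ᵐ[P] f) {A : ℕ → Set Ω}
    (hAm : ∀ n, MeasurableSet (A n)) (hA : Monotone A) (hAU : ⋃ n, A n = Set.univ)
    (hfi : ∀ n, IntegrableOn f (A n) P) {g : Ω → ℝ} (hg : Integrable g P)
    (hfg : ∀ n, ∫ ω in A n, f ω ∂P = ∫ ω in A n, g ω ∂P) (hg0 : ∫ ω, g ω ∂P ≤ 0) :
    f =ᵐ[P] 0 := by
  have hlim : Filter.Tendsto (fun n => ∫ ω in A n, g ω ∂P) Filter.atTop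
      (nhds (∫ ω, g ω ∂P)) := by
    have := tendsto_setIntegral_of_monotone hAm hA hg.integrableOn
    rwa [hAU, setIntegral_univ] at this
  -- These equal the integrals of `f ≥ 0`, hence increase; their limit `∫ g` is at most zero, so all
  -- of them vanish.
  have hmono : Monotone fun n => ∫ ω in A n, g ω ∂P := fun m n hmn => by
    simp only [← hfg]
    exact setIntegral_mono_set (hfi n) (ae_restrict_of_ae hf) (hA hmn).eventuallyLE
  have hle : ∀ n, ∫ ω in A n, f ω ∂P ≤ 0 := fun n => by
    rw [hfg]
    exact (hmono.ge_of_tendsto hlim n).trans hg0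
  have hz : ∀ n, f =ᵐ[P.restrict (A n)] 0 := fun n => by
    refine (integral_eq_zero_iff_of_nonneg_ae (ae_restrict_of_ae hf) (hfi n)).1 ?_
    exact le_antisymm (hle n) (integral_nonneg_of_ae (ae_restrict_of_ae hf))
  rw [← Measure.restrict_univ (μ := P), ← hAU]
  exact (ae_restrict_iUnion_iff _ _).2 hz

/-- The dual constraint is saturated along the primal solution. -/
theorem SolvesPrimal.ae_saturated [IsProbabilityMeasure (unif d)] (hP : Splits P)
    (hXm : Measurable X) (hYm : Measurable Y)
    (hX : Integrable X P) (hX0 : ∫ ω, X ω ∂P = 0) (hY : Integrable Y P)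
    (hU : SolvesPrimal P X Y U) {ψ : E N × E d → ℝ} {φ : E d → ℝ} {b : E d → E N}
    (hdual : SolvesDual (P.map fun ω => (X ω, Y ω)) ψ φ b) :
    ∀ᵐ ω ∂P, U ω ∈ cube d ∧
      (∀ t ∈ cube d, inner ℝ t (Y ω) ≤ ψ (X ω, Y ω) + φ t + inner ℝ (b t) (X ω)) ∧
      ψ (X ω, Y ω) + φ (U ω) + inner ℝ (b (U ω)) (X ω) = inner ℝ (U ω) (Y ω) := by
  have hXY : Measurable fun ω => (X ω, Y ω) := hXm.prodMk hYm
  have hUm := hU.admissible.measurable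
  have hcube := hU.admissible.ae_mem_cube
  have hcon := ae_of_ae_map hXY.aemeasurable hdual.admissible.constraint
  have hψ : Integrable (fun ω => ψ (X ω, Y ω)) P :=
    (integrable_map_measure hdual.admissible.integrable_psi.1 hXY.aemeasurable).1
      hdual.admissible.integrable_psi
  have hφ0 := hdual.admissible.integrable_phi
  have hb0 := hdual.admissible.integrable_b.1
  have hcost := hU.dualCost_le hP hXm hYm hX hX0 hY hdual
  rw [dualCost, integral_map hXY.aemeasurable hdual.admissible.integrable_psi.1] at hcost
  rw [← hU.admissible.law] at hb0
  obtain ⟨b', hb', hbb0⟩ := hb0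
  have hbb' : ∀ᵐ ω ∂P, b (U ω) = b' (U ω) := ae_of_ae_map hUm.aemeasurable hbb0
  rw [← hU.admissible.law] at hφ0 hcost
  have hφ : Integrable (fun ω => φ (U ω)) P :=
    (integrable_map_measure hφ0.1 hUm.aemeasurable).1 hφ0
  rw [integral_map hUm.aemeasurable hφ0.1] at hcost
  have hUY := hU.admissible.integrable_inner hY
  -- The integrable part of the slack `f`; the remaining term `b'(U) · X` integrates to zero on each
  -- set `A n`.
  let g : Ω → ℝ := fun ω => ψ (X ω, Y ω) + φ (U ω) - inner ℝ (U ω) (Y ω)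
  have hg : Integrable g P := (hψ.add hφ).sub hUY
  have hg0 : ∫ ω, g ω ∂P ≤ 0 := by
    have h1 : ∫ ω, g ω ∂P = _ := integral_sub (hψ.add hφ) hUY
    have h2 := integral_add hψ hφ
    exact h1.trans_le (sub_nonpos.2 (h2.trans_le hcost))
  let f : Ω → ℝ := fun ω => g ω + inner ℝ (b' (U ω)) (X ω)
  let A : ℕ → Set Ω := fun n => {ω | ‖b' (U ω)‖ ≤ n}
  have hf0 : 0 ≤ᵐ[P] f := by
    filter_upwards [hcube, hcon, hbb'] with ω h1 h2 h3
    have := h2 (U ω) h1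
    simp only [f, g, Pi.zero_apply, ← h3]
    linarith
  have hA := fun n => hU.admissible.setIntegral_inner_eq_zero hX hb' n
  have hfz : f =ᵐ[P] 0 := by
    refine ae_eq_zero_of_setIntegral_le hf0 (A := A)
      (fun n => hUm (hb'.norm.measurable measurableSet_Iic)) (fun m n hmn ω hω => ?_) ?_
      (fun n => hg.integrableOn.add (hA n).1) hg (fun n => ?_) hg0
    · exact le_trans (α := ℝ) hω (by exact_mod_cast hmn)
    · refine Set.eq_univ_of_forall fun ω => Set.mem_iUnion.2 ?_
      exact exists_nat_ge ‖b' (U ω)‖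
    · have := integral_add hg.integrableOn (hA n).1
      rw [(hA n).2, add_zero] at this
      exact this
  filter_upwards [hcube, hcon, hbb', hfz] with ω h1 h2 h3 h4
  refine ⟨h1, h2, ?_⟩
  rw [h3]
  simp only [f, g, Pi.zero_apply] at h4
  linarith

end ComplementarySlackness

/-! ### Consequences of a touching affine minorant -/

section Subdifferentials

variable {d : ℕ} {f : E d → EReal} {t₀ y₀ : E d} {a : ℝ}

lemma le_conj (f : E d → EReal) (t y : E d) : ((inner ℝ t y : ℝ) : EReal) - f t ≤ conj f y :=
  le_iSup (fun t : E d => ((inner ℝ t y : ℝ) : EReal) - f t) t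

/-- If `t₀` attains the supremum defining `f^*(y₀)`, then `f^*(y₀) = t₀ · y₀ - f(t₀)`. -/
lemma conj_eq_of_affine_le (hf : f t₀ = a)
    (hmin : ∀ t, ((a + inner ℝ y₀ (t - t₀) : ℝ) : EReal) ≤ f t) :
    conj f y₀ = ((inner ℝ t₀ y₀ - a : ℝ) : EReal) := by
  refine le_antisymm (iSup_le fun t => ?_) ?_
  · refine (EReal.sub_le_sub le_rfl (hmin t)).trans ?_
    rw [← EReal.coe_sub, EReal.coe_le_coe_iff, inner_sub_right, real_inner_comm t y₀,
      real_inner_comm t₀ y₀]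
    linarith
  · rw [EReal.coe_sub, ← hf]
    exact le_conj f t₀ y₀

/-- The minorant is exactly the `y₀`-term of the supremum defining the biconjugate. -/
lemma affine_le_conj_conj (hf : f t₀ = a)
    (hmin : ∀ t, ((a + inner ℝ y₀ (t - t₀) : ℝ) : EReal) ≤ f t) (t : E d) :
    ((a + inner ℝ y₀ (t - t₀) : ℝ) : EReal) ≤ conj (conj f) t := by
  refine le_trans (le_of_eq ?_) (le_conj (conj f) y₀ t)
  rw [conj_eq_of_affine_le hf hmin, ← EReal.coe_sub, EReal.coe_eq_coe_iff, inner_sub_right,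
    real_inner_comm t₀ y₀]
  ring

lemma conj_conj_eq_of_affine_le (hf : f t₀ = a)
    (hmin : ∀ t, ((a + inner ℝ y₀ (t - t₀) : ℝ) : EReal) ≤ f t) :
    conj (conj f) t₀ = a := by
  refine le_antisymm (iSup_le fun y => ?_) ?_
  · have h : ((inner ℝ t₀ y - a : ℝ) : EReal) ≤ conj f y := by
      rw [EReal.coe_sub, ← hf]
      exact le_conj f t₀ y
    refine (EReal.sub_le_sub le_rfl h).trans (le_of_eq ?_)
    rw [← EReal.coe_sub, EReal.coe_eq_coe_iff, real_inner_comm t₀ y]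
    ring
  · simpa using affine_le_conj_conj hf hmin t₀

/-- The region above an affine function is convex, so it contains the convex hull of the epigraph as
soon as it contains the epigraph. -/
lemma affine_le_convexEnvelope
    (hmin : ∀ t, ((a + inner ℝ y₀ (t - t₀) : ℝ) : EReal) ≤ f t) (t : E d) :
    ((a + inner ℝ y₀ (t - t₀) : ℝ) : EReal) ≤ convexEnvelope f t := by
  refine le_iInf₂ fun r hr => EReal.coe_le_coe_iff.2 ?_
  have hconv : Convex ℝ {p : E d × ℝ | a + inner ℝ y₀ (p.1 - t₀) ≤ p.2} := by
    intro p hp q hq α β hα hβ hαβ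
    simp only [Set.mem_ofPred_eq, Prod.fst_add, Prod.snd_add, Prod.smul_fst, Prod.smul_snd,
      inner_sub_right, inner_add_right, inner_smul_right, smul_eq_mul] at hp hq ⊢
    have h1 := mul_le_mul_of_nonneg_left hp hα
    have h2 := mul_le_mul_of_nonneg_left hq hβ
    have h3 : a - inner ℝ y₀ t₀ = α * (a - inner ℝ y₀ t₀) + β * (a - inner ℝ y₀ t₀) := by
      rw [← add_mul, hαβ, one_mul]
    linarith
  exact convexHull_min (fun p hp => EReal.coe_le_coe_iff.1 ((hmin p.1).trans hp)) hconv hr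

lemma convexEnvelope_eq_of_affine_le (hf : f t₀ = a)
    (hmin : ∀ t, ((a + inner ℝ y₀ (t - t₀) : ℝ) : EReal) ≤ f t) :
    convexEnvelope f t₀ = a := by
  refine le_antisymm ?_ (by simpa using affine_le_convexEnvelope hmin t₀)
  exact iInf₂_le a (subset_convexHull ℝ {p : E d × ℝ | f p.1 ≤ (p.2 : EReal)} hf.le)

lemma mem_subdiff_of_affine_le (hf : f t₀ = a)
    (hmin : ∀ t, ((a + inner ℝ y₀ (t - t₀) : ℝ) : EReal) ≤ f t) : y₀ ∈ subdiff f t₀ := by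
  refine ⟨by simp [hf], by simp [hf], fun t => ?_⟩
  rw [hf, ← EReal.coe_add]
  exact hmin t

/-- The same principle on the dual side: `y ↦ t₀ · y - f(t₀)` is an affine minorant of the
conjugate, touching it at `y₀`. -/
lemma mem_subdiff_conj_of_affine_le (hf : f t₀ = a)
    (hmin : ∀ t, ((a + inner ℝ y₀ (t - t₀) : ℝ) : EReal) ≤ f t) :
    t₀ ∈ subdiff (conj f) y₀ := by
  refine mem_subdiff_of_affine_le (conj_eq_of_affine_le hf hmin) fun y => ?_
  refine le_trans (le_of_eq ?_) (le_conj f t₀ y)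
  rw [hf, ← EReal.coe_sub, EReal.coe_eq_coe_iff, inner_sub_right]
  ring

end Subdifferentials

end VQR

end

theorem mainTheorem1 {Ω : Type*} [MeasurableSpace Ω] (P : MeasureTheory.Measure Ω)
    [MeasureTheory.IsProbabilityMeasure P] (hP : VQR.Nonatomic P) {N d : ℕ}
    (X : Ω → VQR.E N) (Y : Ω → VQR.E d) (hXm : Measurable X) (hYm : Measurable Y)
    (hX : MeasureTheory.Integrable X P) (hY : MeasureTheory.Integrable Y P)
    (hX0 : ∫ ω, X ω ∂P = 0)
    (U : Ω → VQR.E d) (hU : VQR.SolvesPrimal P X Y U)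
    (ψ : VQR.E N × VQR.E d → ℝ) (φ : VQR.E d → ℝ) (b : VQR.E d → VQR.E N)
    (hdual : VQR.SolvesDual (P.map (fun ω => (X ω, Y ω))) ψ φ b) :
    ∀ᵐ ω ∂P,
      -- contact with the Legendre–Fenchel biconjugate and with the convex envelope
      VQR.Phi φ b (X ω) (U ω) = VQR.conj (VQR.conj (VQR.Phi φ b (X ω))) (U ω) ∧
      VQR.Phi φ b (X ω) (U ω) = VQR.convexEnvelope (VQR.Phi φ b (X ω)) (U ω) ∧
      -- the subdifferential relations
      U ω ∈ VQR.subdiff (VQR.conj (VQR.Phi φ b (X ω))) (Y ω) ∧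
      Y ω ∈ VQR.subdiff (VQR.conj (VQR.conj (VQR.Phi φ b (X ω)))) (U ω) ∧
      Y ω ∈ VQR.subdiff (VQR.convexEnvelope (VQR.Phi φ b (X ω))) (U ω) := by
  have hprob : MeasureTheory.IsProbabilityMeasure (VQR.unif d) := by
    rw [← hU.admissible.law]
    exact MeasureTheory.Measure.isProbabilityMeasure_map hU.admissible.measurable.aemeasurable
  filter_upwards [hU.ae_saturated hP.splits hXm hYm hX hX0 hY hdual] with ω ⟨hcube, hcon, heq⟩
  have hval : VQR.Phi φ b (X ω) (U ω) = ((φ (U ω) + inner ℝ (b (U ω)) (X ω) : ℝ) : EReal) :=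
    if_pos hcube
  -- The constraint at `t` minus the equality at `U ω` eliminates `ψ`; off the cube the bound is
  -- trivial.
  have hmin : ∀ t, ((φ (U ω) + inner ℝ (b (U ω)) (X ω) + inner ℝ (Y ω) (t - U ω) : ℝ) : EReal) ≤
      VQR.Phi φ b (X ω) t := fun t => by
    by_cases ht : t ∈ VQR.cube d
    · rw [VQR.Phi, if_pos ht, EReal.coe_le_coe_iff, inner_sub_right, real_inner_comm t,
        real_inner_comm (U ω)]
      linarith [hcon t ht]
    · rw [VQR.Phi, if_neg ht]
      exact le_top
  refine ⟨?_, ?_, VQR.mem_subdiff_conj_of_affine_le hval hmin, ?_, ?_⟩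
  · rw [hval, VQR.conj_conj_eq_of_affine_le hval hmin]
  · rw [hval, VQR.convexEnvelope_eq_of_affine_le hval hmin]
  · exact VQR.mem_subdiff_of_affine_le (VQR.conj_conj_eq_of_affine_le hval hmin)
      (VQR.affine_le_conj_conj hval hmin)
  · exact VQR.mem_subdiff_of_affine_le (VQR.convexEnvelope_eq_of_affine_le hval hmin)
      (VQR.affine_le_convexEnvelope hmin)
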